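/- **Setting.** Let $\Gamma$ be a Riemannian circle, i.e. a rectifiable simple closed curve in $\mathbb{R}^d$, of length $|\Gamma|$. The geodesic distance $d(x,y)$ of $x,y\in\Gamma$ is the length of the shorter arc of $\Gamma$ joining them. For $f:[0,|\Gamma|/2]\to\mathbb{C}\cup\{+\infty\}$ and points $z_{1,N},\dots,z_{N,N}$ on $\Gamma$ that are equally spaced with respect to arclength, put $$\mathcal{M}(\Gamma,f;N)=\sum_{j\neq k} f\big(d(z_{j,N},z_{k,N})\big).$$ Let $p\ge 1$ and $q\ge 0$ be integers. Suppose $f$ is *admissible*: (i) $f$ has a continuous derivative of order $2p+1$ on $(0,|\Gamma|/2]$ (one-sided at $|\Gamma|/2$); (ii) there are complex numbers $a_n,s_n$ ($0\le n\le q$) with $\operatorname{Re}s_0>\operatorname{Re}s_1>\dots>\operatorname{Re}s_q$ and with $\operatorname{Re}s_q+2p>0$ or $s_q=-2p$, and a $\delta>0$ with $1-\operatorname{Re}s_q+\delta>0$, such that $S_q(x)=\sum_{n=0}^q a_n x^{-s_n}$ (principal values) satisfies, as $x\to0^+$, $$\int_0^x (f-S_q)(y)\,dy=\mathcal{O}(x^{1+\delta-s_q}),\qquad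 (f-S_q)^{(\nu)}(x)=\mathcal{O}(x^{\delta-s_q-\nu})\quad(\nu=0,1,\dots,2p+1).$$ For $N=2M+\kappa$ with $\kappa\in\{0,1\}$ let $$\mathcal{B}_p(\Gamma,f;N)=\frac{2}{|\Gamma|}N^2\sum_{n=1}^p\frac{B_{2n}(\kappa/2)}{(2n)!}\Big(\frac{|\Gamma|}{N}\Big)^{2n}f^{(2n-1)}(|\Gamma|/2),$$ where $B_m(x)$ is the $m$-th Bernoulli polynomial. Let $\zeta$ be the Riemann zeta function and $\gamma$ the Euler–Mascheroni constant. **Theorem (exceptional case).** Suppose in addition that $s_{q'}=1$ for some $0\le q'\le q$. Then $f-S_q$ is integrable on $(0,|\Gamma|/2)$, and for $N=2M+\kappa$, $\kappa\in\{0,1\}$, $$\mathcal{M}(\Gamma,f;N)=\frac{2}{|\Gamma|}a_{q'}N^2\log N+V_f(\Gamma)N^2+\sum_{\substack{n=0\\ n\ne q'}}^q a_n\frac{2\zeta(s_n)}{|\Gamma|^{s_n}}N^{1+s_n}+\mathcal{B}_p(\Gamma,f;N)+\mathfrak{R}_p(\Gamma,f;N),$$ where $$V_f(\Gamma)=\frac{2}{|\Gamma|}\Big\{\sum_{\substack{n=0\\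 n\ne q'}}^q a_n\frac{(|\Gamma|/2)^{1-s_n}}{1-s_n}+\int_0^{|\Gamma|/2}(f-S_q)(x)\,dx-a_{q'}(\log2-\gamma)\Big\}$$ and, as $N\to\infty$, the remainder satisfies $\mathfrak{R}_p(\Gamma,f;N)=\mathcal{O}(N^{1-2p})+\mathcal{O}(N^{1-\delta+s_q})$ if $2p\ne\delta-\operatorname{Re}s_q$, and $\mathfrak{R}_p(\Gamma,f;N)=\mathcal{O}(N^{1-2p}\log N)$ if $2p=\delta-\operatorname{Re}s_q$. -/

import Mathlib

open Set Filter Topology Asymptotics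

noncomputable section

/-- A Riemannian circle: a rectifiable simple closed curve in `ℝ^d`, given by a parametrization
on `[0, 1]` that is continuous, closed, injective on `[0, 1)` and of finite length. -/
structure RiemannianCircle (d : ℕ) where
  param : ℝ → EuclideanSpace ℝ (Fin d)
  continuousOn : ContinuousOn param (Icc 0 1)
  closed : param 0 = param 1
  injOn : InjOn param (Ico 0 1)
  rectifiable : eVariationOn param (Icc 0 1) ≠ ⊤

namespace RiemannianCircle

variable {d : ℕ}

/-- The set of points of the curve. -/
def carrier (Γ : RiemannianCircle d) : Set (EuclideanSpace ℝ (Fin d)) :=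
  Γ.param '' Ico 0 1

/-- The length `|Γ|` of the curve. -/
def length (Γ : RiemannianCircle d) : ℝ :=
  (eVariationOn Γ.param (Icc 0 1)).toReal

/-- The unique parameter in `[0, 1)` of a point of the curve. -/
def coord (Γ : RiemannianCircle d) (x : EuclideanSpace ℝ (Fin d)) : ℝ :=
  Function.invFunOn Γ.param (Ico 0 1) x

/-- The length `ℓ(x, y)` of the arc of `Γ` that starts at `x` and runs to `y` in the direction
of the parametrization (through the base point `param 0 = param 1` if necessary). -/
def arcLength (Γ : RiemannianCircle d) (x y : EuclideanSpace ℝ (Fin d)) : ℝ :=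
  if Γ.coord x ≤ Γ.coord y then
    (eVariationOn Γ.param (Icc (Γ.coord x) (Γ.coord y))).toReal
  else
    (eVariationOn Γ.param (Icc (Γ.coord x) 1)).toReal +
      (eVariationOn Γ.param (Icc 0 (Γ.coord y))).toReal

/-- The geodesic distance: the length of the shorter one of the two arcs joining `x` and `y`. -/
def geodesicDist (Γ : RiemannianCircle d) (x y : EuclideanSpace ℝ (Fin d)) : ℝ :=
  min (Γ.arcLength x y) (Γ.arcLength y x)

/-- `z` lists `N` points of `Γ`, equally spaced with respect to arclength, in the order in which
they occur along `Γ`: each of the `N - 1` arcs from a point to the next one has length `|Γ| / N`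
(and then so does the arc from the last point back to the first one). -/
def IsEquallySpaced (Γ : RiemannianCircle d) {N : ℕ}
    (z : Fin N → EuclideanSpace ℝ (Fin d)) : Prop :=
  (∀ j, z j ∈ Γ.carrier) ∧
    ∀ j k : Fin N, (k : ℕ) = (j : ℕ) + 1 → Γ.arcLength (z j) (z k) = Γ.length / N

/-- The discrete geodesic `f`-energy `∑_{j ≠ k} f (d(z_j, z_k))` of a point configuration. -/
def energy (Γ : RiemannianCircle d) (f : ℝ → ℂ) {N : ℕ}
    (z : Fin N → EuclideanSpace ℝ (Fin d)) : ℂ :=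
  ∑ j, ∑ k ∈ Finset.univ.filter (fun k => k ≠ j), f (Γ.geodesicDist (z j) (z k))

end RiemannianCircle

/-- `S_q(x) = ∑_{n = 0}^q a_n x^{-s_n}`, with principal values of the powers. -/
def powerSum {q : ℕ} (a s : Fin (q + 1) → ℂ) (x : ℝ) : ℂ :=
  ∑ n, a n * (x : ℂ) ^ (-s n)

/-- Admissibility of a kernel on `[0, L / 2]`, with the data `p, q, a, s, δ` made explicit.
Kernels are functions `ℝ → ℂ` of which only the restriction to `(0, L / 2]` is ever used (the
value at `0`, which may be infinite, plays no role); derivatives at `L / 2` are one-sided. -/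
structure IsAdmissible (L : ℝ) (f : ℝ → ℂ) (p : ℕ) {q : ℕ} (a s : Fin (q + 1) → ℂ)
    (δ : ℝ) : Prop where
  contDiffOn : ContDiffOn ℝ ((2 * p + 1 : ℕ) : WithTop ℕ∞) f (Ioc 0 (L / 2))
  re_strictAnti : StrictAnti fun n => (s n).re
  last_exponent : 0 < (s (Fin.last q)).re + 2 * p ∨ s (Fin.last q) = -(2 * p : ℂ)
  delta_pos : 0 < δ
  exponent_pos : 0 < 1 - (s (Fin.last q)).re + δ
  integral_isBigO :
    (fun x : ℝ => ∫ y in (0 : ℝ)..x, (f y - powerSum a s y))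
      =O[𝓝[>] 0] fun x : ℝ => (x : ℂ) ^ (1 + (δ : ℂ) - s (Fin.last q))
  deriv_isBigO : ∀ ν : ℕ, ν ≤ 2 * p + 1 →
    (fun x : ℝ => iteratedDerivWithin ν (fun y => f y - powerSum a s y) (Ioc 0 (L / 2)) x)
      =O[𝓝[>] 0] fun x : ℝ => (x : ℂ) ^ ((δ : ℂ) - s (Fin.last q) - (ν : ℂ))

/-- The sum `B_p(Γ, f; N)` for `|Γ| = L`, where `N = 2 M + κ`, `κ = N % 2`. -/
def bernoulliSum (L : ℝ) (f : ℝ → ℂ) (p N : ℕ) : ℂ :=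
  2 / (L : ℂ) * (N : ℂ) ^ 2 *
    ∑ n ∈ Finset.Icc 1 p,
      ((((Polynomial.bernoulli (2 * n)).eval (((N % 2 : ℕ) : ℚ) / 2) : ℚ) : ℂ)
          / ((2 * n).factorial : ℂ))
        * ((L : ℂ) / (N : ℂ)) ^ (2 * n)
        * iteratedDerivWithin (2 * n - 1) f (Ioc 0 (L / 2)) (L / 2)

/-- The coefficient `V_f(Γ)` of `N ^ 2` for `|Γ| = L`, in the case `s q' = 1`. -/
def exceptionalCoeff (L : ℝ) (f : ℝ → ℂ) {q : ℕ} (a s : Fin (q + 1) → ℂ)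
    (q' : Fin (q + 1)) : ℂ :=
  2 / (L : ℂ) *
    ((∑ n ∈ Finset.univ.erase q', a n * (((L / 2 : ℝ) : ℂ) ^ (1 - s n) / (1 - s n)))
      + (∫ x in (0 : ℝ)..(L / 2), (f x - powerSum a s x))
      - a q' * ((Real.log 2 - Real.eulerMascheroniConstant : ℝ) : ℂ))

/-- The explicit part of the asymptotic expansion for `|Γ| = L`, in the case `s q' = 1`. -/
def exceptionalExpansion (L : ℝ) (f : ℝ → ℂ) (p : ℕ) {q : ℕ} (a s : Fin (q + 1) → ℂ)
    (q' : Fin (q + 1)) (N : ℕ) : ℂ :=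
  2 / (L : ℂ) * a q' * (N : ℂ) ^ 2 * ((Real.log N : ℝ) : ℂ)
    + exceptionalCoeff L f a s q' * (N : ℂ) ^ 2
    + ∑ n ∈ Finset.univ.erase q',
        a n * (2 * riemannZeta (s n) / (L : ℂ) ^ (s n)) * (N : ℂ) ^ (1 + s n)
    + bernoulliSum L f p N

end

/-! Rotating an equally spaced configuration by one point leaves it unchanged, so the energy is `N`
times a sum over one point's distances. Pairing `m` with `N - m` turns it into `discreteSum`: values
of `f` at `n * h` with `h = |Γ| / N`, `n ≤ N / 2`, where a `B_1(κ/2)` term corrects for the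
antipodal point.

Euler-Maclaurin summation is applied on `[1, N / 2]` with the possibly half-integral endpoint kept.
Its boundary terms there carry `B_k(κ/2)`: the one with `k = 1` cancels the antipodal correction,
the other odd ones vanish, and the even ones form `B_p`.

Write `f = g + S_q`. For a pure power `x ^ (-s)` the remainder integral converges at infinity, and
the constant left over is `riemannZeta₀ s`, that is `ζ(s) - 1 / (s - 1)`, first for `Re s > 1` and
then by analytic continuation (`eulerMaclaurinConst_eq`). As this function is entire with value `γ`
at `1`, the exponent `1` is treated like the others; only there the integral is `log (N / 2)`, the
source of `N² log N`. Powers leave an error `O(N ^ (-2p))` (`discreteSum_powDeriv_sub_le`).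

For `g`, with `k`-th derivative `O(x ^ (α - k))` and `α = δ - Re s_q > -1`, all that happens near
`0` costs `O(h ^ α)`, and the remainder integral costs `h ^ α` times the integral of `x ^ (α - 2p -
1)` over `[1, N / 2]` (`discreteSum_sub_le`). The size of that integral separates the two remainder
regimes. -/

noncomputable section

/-! ### Bernoulli polynomials and Euler-Maclaurin summation -/

/-- The normalized Bernoulli polynomial `B_k(x) / k!`. -/
def normBernoulli (k : ℕ) (x : ℝ) : ℂ := ((bernoulliFun k x / (k.factorial : ℝ) : ℝ) : ℂ)

/-- The one-periodic extension of `normBernoulli k` from `[0, 1)`. -/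
def periodicBernoulli (k : ℕ) (x : ℝ) : ℂ := normBernoulli k (Int.fract x)

theorem continuous_normBernoulli (k : ℕ) : Continuous (normBernoulli k) := by
  unfold normBernoulli
  fun_prop

theorem normBernoulli_zero (x : ℝ) : normBernoulli 0 x = 1 := by
  simp [normBernoulli]

theorem normBernoulli_one (x : ℝ) : normBernoulli 1 x = x - 1 / 2 := by
  simp [normBernoulli]

theorem hasDerivAt_normBernoulli (k : ℕ) (x : ℝ) :
    HasDerivAt (normBernoulli (k + 1)) (normBernoulli k x) x := by
  have h := ((hasDerivAt_bernoulliFun (k + 1) x).div_const ((k + 1).factorial : ℝ)).ofReal_comp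
  refine h.congr_deriv ?_
  unfold normBernoulli
  congr 1
  rw [Nat.factorial_succ, Nat.add_sub_cancel]
  have : (k.factorial : ℝ) ≠ 0 := by positivity
  push_cast
  field_simp

theorem normBernoulli_eval_one (k : ℕ) :
    normBernoulli k 1 = normBernoulli k 0 + if k = 1 then 1 else 0 := by
  unfold normBernoulli
  rw [bernoulliFun_eval_one]
  split_ifs with h
  · subst h; simp
  · simp

theorem measurable_periodicBernoulli (k : ℕ) : Measurable (periodicBernoulli k) :=
  (continuous_normBernoulli k).measurable.comp measurable_fract

theorem exists_norm_periodicBernoulli_le (k : ℕ) : ∃ C, 0 ≤ C ∧ ∀ x, ‖periodicBernoulli k x‖ ≤ C := by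
  obtain ⟨C, hC⟩ := (isCompact_Icc (a := (0 : ℝ)) (b := 1)).exists_bound_of_continuousOn
    (continuous_normBernoulli k).continuousOn
  have h : ∀ x, ‖periodicBernoulli k x‖ ≤ C := fun x =>
    hC _ ⟨Int.fract_nonneg x, (Int.fract_lt_one x).le⟩
  exact ⟨C, (norm_nonneg _).trans (h 0), h⟩

theorem periodicBernoulli_eq {k n : ℕ} {x : ℝ} (h1 : (n : ℝ) < x) (h2 : x < n + 1) :
    periodicBernoulli k x = normBernoulli k (x - n) := by
  have : ⌊x⌋ = n := Int.floor_eq_iff.2 ⟨by exact_mod_cast h1.le, by exact_mod_cast h2⟩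
  rw [periodicBernoulli, Int.fract, this]
  simp

theorem intervalIntegrable_periodicBernoulli_mul (k : ℕ) {g : ℝ → ℂ} {a b : ℝ}
    (hg : IntervalIntegrable g MeasureTheory.volume a b) :
    IntervalIntegrable (fun x => periodicBernoulli k x * g x) MeasureTheory.volume a b := by
  obtain ⟨C, -, hC⟩ := exists_norm_periodicBernoulli_le k
  constructor
  · exact hg.1.bdd_mul (measurable_periodicBernoulli k).aestronglyMeasurable
      (Eventually.of_forall hC)
  · exact hg.2.bdd_mul (measurable_periodicBernoulli k).aestronglyMeasurable
      (Eventually.of_forall hC)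

/-- Repeated integration by parts against Bernoulli polynomials on part of a unit interval. -/
theorem integral_eq_sum_normBernoulli {φ : ℕ → ℝ → ℂ} {m : ℕ} {a b : ℝ} (hab : a ≤ b)
    (hc : ∀ k ≤ m, ContinuousOn (φ k) (Icc a b))
    (hd : ∀ k < m, ∀ x ∈ Ioo a b, HasDerivAt (φ k) (φ (k + 1) x) x) :
    ∫ x in a..b, φ 0 x =
      ∑ k ∈ Finset.range m, (-1) ^ k *
        (normBernoulli (k + 1) (b - a) * φ k b - normBernoulli (k + 1) 0 * φ k a)
      + (-1) ^ m * ∫ x in a..b, normBernoulli m (x - a) * φ m x := by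
  induction m with
  | zero => simp [normBernoulli_zero]
  | succ m ih =>
    rw [ih (fun k hk => hc k (by omega)) (fun k hk => hd k (by omega)), Finset.sum_range_succ]
    have hP : ∀ x, HasDerivAt (fun x => normBernoulli (m + 1) (x - a))
        (normBernoulli m (x - a)) x := fun x => by
      simpa using (hasDerivAt_normBernoulli m (x - a)).comp_sub_const x a
    have hPc : Continuous fun x => normBernoulli m (x - a) :=
      (continuous_normBernoulli m).comp (by fun_prop)
    have key := intervalIntegral.integral_mul_deriv_eq_deriv_mul_of_hasDerivAt
      (u := φ m) (v := fun x => normBernoulli (m + 1) (x - a)) (u' := φ (m + 1))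
      (v' := fun x => normBernoulli m (x - a)) (a := a) (b := b)
      (by rw [uIcc_of_le hab]; exact hc m (by omega))
      ((continuous_iff_continuousAt.2 fun x => (hP x).continuousAt).continuousOn)
      (by rw [min_eq_left hab, max_eq_right hab]; exact hd m (by omega))
      (fun x _ => hP x)
      ((hc (m + 1) le_rfl).intervalIntegrable_of_Icc hab)
      (hPc.intervalIntegrable _ _)
    have e1 : ∫ x in a..b, normBernoulli m (x - a) * φ m x
        = ∫ x in a..b, φ m x * normBernoulli m (x - a) := by simp_rw [mul_comm]
    have e2 : ∫ x in a..b, normBernoulli (m + 1) (x - a) * φ (m + 1) x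
        = ∫ x in a..b, φ (m + 1) x * normBernoulli (m + 1) (x - a) := by simp_rw [mul_comm]
    rw [e1, key, e2, sub_self]
    ring

/-- The Euler-Maclaurin formula with an upper endpoint that need not be an integer. -/
theorem sum_eq_integral_add_normBernoulli {φ : ℕ → ℝ → ℂ} {m : ℕ} (hm : 1 ≤ m) {M : ℕ}
    (hM : 1 ≤ M) {y : ℝ} (hy1 : (M : ℝ) ≤ y) (hy2 : y ≤ M + 1)
    (hc : ∀ k ≤ m, ContinuousOn (φ k) (Icc 1 y))
    (hd : ∀ k < m, ∀ x ∈ Ioo 1 y, HasDerivAt (φ k) (φ (k + 1) x) x) :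
    ∑ n ∈ Finset.Icc 1 M, φ 0 n =
      (∫ x in (1 : ℝ)..y, φ 0 x)
      + (φ 0 1 + ∑ k ∈ Finset.range m, (-1) ^ k * (normBernoulli (k + 1) 0 * φ k 1))
      - ∑ k ∈ Finset.range m, (-1) ^ k * (normBernoulli (k + 1) (y - M) * φ k y)
      - (-1) ^ m * ∫ x in (1 : ℝ)..y, periodicBernoulli m x * φ m x := by
  have piece : ∀ (n : ℕ) (b : ℝ), 1 ≤ n → (n : ℝ) ≤ b → b ≤ n + 1 → b ≤ y →
      ∫ x in (n : ℝ)..b, φ 0 x =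
      ∑ k ∈ Finset.range m, (-1) ^ k *
        (normBernoulli (k + 1) (b - n) * φ k b - normBernoulli (k + 1) 0 * φ k n)
      + (-1) ^ m * ∫ x in (n : ℝ)..b, periodicBernoulli m x * φ m x := by
    intro n b hn h1 h2 h3
    have hn' : (1 : ℝ) ≤ n := by exact_mod_cast hn
    rw [integral_eq_sum_normBernoulli h1 (fun k hk => (hc k hk).mono (Icc_subset_Icc hn' h3))
      (fun k hk x hx => hd k hk x ⟨hn'.trans_lt hx.1, hx.2.trans_le h3⟩)]
    congr 2
    -- The periodic extension may jump at integers, so the integrands are compared on the open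
    -- interval only.
    refine intervalIntegral.integral_congr_uIoo ?_
    rw [uIoo_of_le h1]
    intro x hx
    simp only
    rw [periodicBernoulli_eq hx.1 (hx.2.trans_le h2)]
  have hint : ∀ k ≤ m, ∀ u v, 1 ≤ u → u ≤ v → v ≤ y →
      IntervalIntegrable (φ k) MeasureTheory.volume u v := fun k hk u v h1 h2 h3 =>
    ((hc k hk).mono (Icc_subset_Icc h1 h3)).intervalIntegrable_of_Icc h2
  have main : ∀ M : ℕ, 1 ≤ M → ∀ b : ℝ, (M : ℝ) ≤ b → b ≤ M + 1 → b ≤ y →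
      ∑ n ∈ Finset.Icc 1 M, φ 0 n =
      (∫ x in (1 : ℝ)..b, φ 0 x)
      + (φ 0 1 + ∑ k ∈ Finset.range m, (-1) ^ k * (normBernoulli (k + 1) 0 * φ k 1))
      - ∑ k ∈ Finset.range m, (-1) ^ k * (normBernoulli (k + 1) (b - M) * φ k b)
      - (-1) ^ m * ∫ x in (1 : ℝ)..b, periodicBernoulli m x * φ m x := by
    intro M hM
    induction M, hM using Nat.le_induction with
    | base =>
      intro b h1 h2 h3
      have := piece 1 b le_rfl h1 h2 h3
      simp only [Nat.cast_one] at this ⊢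
      rw [this]
      simp only [Finset.Icc_self, Finset.sum_singleton, Nat.cast_one, mul_sub,
        Finset.sum_sub_distrib]
      ring
    | succ M hM ih =>
      intro b h1 h2 h3
      have hM' : (1 : ℝ) ≤ M := by exact_mod_cast hM
      push_cast at h1 h2
      have p := piece (M + 1) b (by omega) (by push_cast; exact h1) (by push_cast; exact h2) h3
      have i := ih (M + 1) (by linarith) le_rfl (h1.trans h3)
      rw [Finset.sum_Icc_succ_top (by omega), i]
      push_cast at p ⊢
      rw [← intervalIntegral.integral_add_adjacent_intervals
          (hint 0 (by omega) 1 (M + 1) le_rfl (by linarith) (h1.trans h3))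
          (hint 0 (by omega) (M + 1) b (by linarith) h1 h3),
        ← intervalIntegral.integral_add_adjacent_intervals
          (intervalIntegrable_periodicBernoulli_mul m
            (hint m le_rfl 1 (M + 1) le_rfl (by linarith) (h1.trans h3)))
          (intervalIntegrable_periodicBernoulli_mul m
            (hint m le_rfl (M + 1) b (by linarith) h1 h3)), p]
      -- At an inner node the Bernoulli values at `1` and at `0` differ only in degree one, by `1`.
      -- This jump supplies the new summand `φ 0 (M + 1)`; it needs `1 ≤ m`.
      have e : ∑ k ∈ Finset.range m, (-1 : ℂ) ^ k *
            (normBernoulli (k + 1) ((M : ℝ) + 1 - M) * φ k (M + 1))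
          = ∑ k ∈ Finset.range m, (-1 : ℂ) ^ k * (normBernoulli (k + 1) 0 * φ k (M + 1))
            + φ 0 (M + 1) := by
        obtain ⟨m, rfl⟩ := Nat.exists_eq_add_of_le' hm
        rw [Finset.sum_range_succ', Finset.sum_range_succ' _ m]
        simp only [add_sub_cancel_left, normBernoulli_eval_one]
        simp
        ring
      rw [e]
      simp only [mul_sub, Finset.sum_sub_distrib]
      ring
  exact main M hM y hy1 hy2 le_rfl

/-- The reflection `x ↦ 1 - x` changes the sign of `B_k` for odd `k`. It fixes `1 / 2`, and it swaps
`0` and `1`, where `B_k` takes equal values unless `k = 1`. -/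
theorem normBernoulli_odd_eq_zero {k κ : ℕ} (hk : Odd k) (hk1 : k ≠ 1) (hκ : κ < 2) :
    normBernoulli k ((κ : ℝ) / 2) = 0 := by
  have h := bernoulliFun_eval_one_sub (k := k) (x := (κ : ℝ) / 2)
  have h2 : bernoulliFun k (1 - (κ : ℝ) / 2) = bernoulliFun k ((κ : ℝ) / 2) := by
    interval_cases κ
    · simpa using bernoulliFun_endpoints_eq_of_ne_one hk1
    · norm_num
  rw [h2, hk.neg_one_pow] at h
  have : bernoulliFun k ((κ : ℝ) / 2) = 0 := by linarith
  simp [normBernoulli, this]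

/-! ### Partial sums of powers and the zeta constant -/

/-- The `k`-th derivative of `x ↦ x ^ (-s)` on the positive reals. -/
def powDeriv (s : ℂ) (k : ℕ) (x : ℝ) : ℂ :=
  (∏ j ∈ Finset.range k, (-s - j)) * (x : ℂ) ^ (-s - k)

theorem powDeriv_zero (s : ℂ) (x : ℝ) : powDeriv s 0 x = (x : ℂ) ^ (-s) := by
  simp [powDeriv]

theorem powDeriv_one_right (s : ℂ) (k : ℕ) :
    powDeriv s k 1 = ∏ j ∈ Finset.range k, (-s - j) := by
  simp [powDeriv]

theorem hasDerivAt_powDeriv (s : ℂ) (k : ℕ) {x : ℝ} (hx : 0 < x) :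
    HasDerivAt (powDeriv s k) (powDeriv s (k + 1) x) x := by
  have h : HasDerivAt (fun z : ℂ => z ^ (-s - k)) ((-s - k) * (x : ℂ) ^ (-s - k - 1) * 1) (x : ℂ) :=
    (hasDerivAt_id (x : ℂ)).cpow_const (Or.inl (by simpa using hx))
  refine (h.comp_ofReal.const_mul (∏ j ∈ Finset.range k, (-s - (j : ℂ)))).congr_deriv ?_
  rw [powDeriv, Finset.prod_range_succ]
  push_cast
  rw [show -s - ((k : ℂ) + 1) = -s - k - 1 by ring]
  ring

theorem continuousOn_powDeriv (s : ℂ) (k : ℕ) : ContinuousOn (powDeriv s k) (Ioi 0) :=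
  fun _ hx => (hasDerivAt_powDeriv s k hx).continuousAt.continuousWithinAt

theorem powDeriv_mul (s : ℂ) (k : ℕ) {h x : ℝ} (hh : 0 < h) (hx : 0 < x) :
    (h : ℂ) ^ k * powDeriv s k (h * x) = (h : ℂ) ^ (-s) * powDeriv s k x := by
  have h0 : (h : ℂ) ≠ 0 := by exact_mod_cast hh.ne'
  have e : (h : ℂ) ^ (-s - (k : ℂ)) = (h : ℂ) ^ (-s) / (h : ℂ) ^ k := by
    rw [Complex.cpow_sub _ _ h0, Complex.cpow_natCast]
  rw [powDeriv, powDeriv, Complex.ofReal_mul, Complex.mul_cpow_ofReal_nonneg hh.le hx.le, e]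
  field_simp

theorem norm_powDeriv (s : ℂ) (k : ℕ) {x : ℝ} (hx : 0 < x) :
    ‖powDeriv s k x‖ = ‖∏ j ∈ Finset.range k, (-s - (j : ℂ))‖ * x ^ (-s.re - k) := by
  rw [powDeriv, norm_mul, Complex.norm_cpow_eq_rpow_re_of_pos hx]
  simp

theorem integrableOn_powDeriv {s : ℂ} {m : ℕ} (hs : 1 - (m : ℝ) < s.re) {c : ℝ} (hc : 0 < c) :
    MeasureTheory.IntegrableOn (powDeriv s m) (Ioi c) := by
  refine (integrableOn_Ioi_cpow_of_lt ?_ hc).const_mul _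
  simp only [Complex.sub_re, Complex.neg_re, Complex.natCast_re]
  linarith

theorem integrableOn_periodicBernoulli_mul_powDeriv {s : ℂ} {m : ℕ} (hs : 1 - (m : ℝ) < s.re)
    {c : ℝ} (hc : 0 < c) :
    MeasureTheory.IntegrableOn (fun x => periodicBernoulli m x * powDeriv s m x) (Ioi c) := by
  obtain ⟨C, -, hC⟩ := exists_norm_periodicBernoulli_le m
  exact (integrableOn_powDeriv hs hc).bdd_mul
    (measurable_periodicBernoulli m).aestronglyMeasurable (Eventually.of_forall hC)

/-- The constant term in the Euler-Maclaurin expansion of the partial sums of `∑ n ^ (-s)`. -/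
def eulerMaclaurinConst (m : ℕ) (s : ℂ) : ℂ :=
  (powDeriv s 0 1 + ∑ k ∈ Finset.range m, (-1) ^ k * (normBernoulli (k + 1) 0 * powDeriv s k 1))
    - (-1) ^ m * ∫ x in Ioi (1 : ℝ), periodicBernoulli m x * powDeriv s m x

theorem sum_powDeriv_eq (s : ℂ) {m : ℕ} (hm : 1 ≤ m) {M : ℕ}
    (hM : 1 ≤ M) {y : ℝ} (hy1 : (M : ℝ) ≤ y) (hy2 : y ≤ M + 1) :
    ∑ n ∈ Finset.Icc 1 M, powDeriv s 0 n =
      (∫ x in (1 : ℝ)..y, powDeriv s 0 x)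
      + (powDeriv s 0 1
        + ∑ k ∈ Finset.range m, (-1) ^ k * (normBernoulli (k + 1) 0 * powDeriv s k 1))
      - ∑ k ∈ Finset.range m, (-1) ^ k * (normBernoulli (k + 1) (y - M) * powDeriv s k y)
      - (-1) ^ m * ∫ x in (1 : ℝ)..y, periodicBernoulli m x * powDeriv s m x := by
  refine sum_eq_integral_add_normBernoulli hm hM hy1 hy2 (fun k _ => ?_) fun k _ x hx => ?_
  · exact (continuousOn_powDeriv s k).mono fun x hx => zero_lt_one.trans_le hx.1
  · exact hasDerivAt_powDeriv s k (zero_lt_one.trans hx.1)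

/-- The condition on `s.re` makes the remainder integral converge at infinity. Splitting it at `y`
puts everything independent of `y` into one constant. -/
theorem sum_powDeriv_eq_add_const {s : ℂ} {m : ℕ} (hm : 1 ≤ m) (hs : 1 - (m : ℝ) < s.re) {M : ℕ}
    (hM : 1 ≤ M) {y : ℝ} (hy1 : (M : ℝ) ≤ y) (hy2 : y ≤ M + 1) :
    ∑ n ∈ Finset.Icc 1 M, powDeriv s 0 n =
      (∫ x in (1 : ℝ)..y, powDeriv s 0 x) + eulerMaclaurinConst m s
      - ∑ k ∈ Finset.range m, (-1) ^ k * (normBernoulli (k + 1) (y - M) * powDeriv s k y)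
      + (-1) ^ m * ∫ x in Ioi y, periodicBernoulli m x * powDeriv s m x := by
  have h1M : (1 : ℝ) ≤ M := by exact_mod_cast hM
  rw [sum_powDeriv_eq s hm hM hy1 hy2, eulerMaclaurinConst,
    ← intervalIntegral.integral_interval_add_Ioi
      (integrableOn_periodicBernoulli_mul_powDeriv hs zero_lt_one)
      (integrableOn_periodicBernoulli_mul_powDeriv hs (by linarith : 0 < y))]
  ring

theorem tendsto_powDeriv_natCast {s : ℂ} (hs : 0 < s.re) (k : ℕ) :
    Tendsto (fun M : ℕ => powDeriv s k M) atTop (𝓝 0) := by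
  rw [tendsto_zero_iff_norm_tendsto_zero]
  have h : Tendsto (fun M : ℕ => ‖∏ j ∈ Finset.range k, (-s - (j : ℂ))‖
      * (M : ℝ) ^ (-(s.re + k))) atTop (𝓝 0) := by
    simpa using ((tendsto_rpow_neg_atTop (by positivity : 0 < s.re + k)).comp
      tendsto_natCast_atTop_atTop).const_mul ‖∏ j ∈ Finset.range k, (-s - (j : ℂ))‖
  refine h.congr' ?_
  filter_upwards [eventually_gt_atTop 0] with M hM
  rw [norm_powDeriv s k (by exact_mod_cast hM), neg_add']

/-- Let `y = M → ∞` in the summation formula: the boundary terms die, the sum tends to `ζ(s)`, and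
the integral tends to the pole part `1 / (s - 1)`. -/
theorem eulerMaclaurinConst_eq_of_one_lt {m : ℕ} (hm : 1 ≤ m) {s : ℂ} (hs : 1 < s.re) :
    eulerMaclaurinConst m s = riemannZeta₀ s := by
  have hm' : (1 : ℝ) ≤ m := by exact_mod_cast hm
  have hs1 : s ≠ 1 := by rintro rfl; simp at hs
  have hsum : Tendsto (fun M : ℕ => ∑ n ∈ Finset.Icc 1 M, powDeriv s 0 n) atTop
      (𝓝 (riemannZeta s)) := by
    have h := ((Complex.summable_one_div_nat_cpow.2 hs).hasSum.tendsto_sum_nat).comp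
      (tendsto_add_atTop_nat 1)
    rw [← zeta_eq_tsum_one_div_nat_cpow hs] at h
    refine h.congr fun M => ?_
    have h0 : s ≠ 0 := by rintro rfl; simp at hs; linarith
    simp only [Function.comp_apply, Finset.sum_range_succ']
    rw [Finset.range_eq_Ico, Finset.sum_Ico_add' (fun n : ℕ => 1 / (n : ℂ) ^ s) 0 M 1]
    simp only [Nat.cast_zero, Complex.zero_cpow h0, div_zero, add_zero, zero_add]
    refine Finset.sum_congr rfl fun n _ => ?_
    rw [powDeriv_zero, Complex.cpow_neg]
    simp
  have hlim : Tendsto (fun M : ℕ => (∫ x in (1 : ℝ)..M, powDeriv s 0 x)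
      + (powDeriv s 0 1
        + ∑ k ∈ Finset.range m, (-1) ^ k * (normBernoulli (k + 1) 0 * powDeriv s k 1))
      - ∑ k ∈ Finset.range m, (-1) ^ k * (normBernoulli (k + 1) ((M : ℝ) - M) * powDeriv s k M)
      - (-1) ^ m * ∫ x in (1 : ℝ)..M, periodicBernoulli m x * powDeriv s m x) atTop
      (𝓝 ((∫ x in Ioi (1 : ℝ), powDeriv s 0 x)
      + (powDeriv s 0 1
        + ∑ k ∈ Finset.range m, (-1) ^ k * (normBernoulli (k + 1) 0 * powDeriv s k 1))
      - ∑ k ∈ Finset.range m, (-1) ^ k * (normBernoulli (k + 1) 0 * 0)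
      - (-1) ^ m * ∫ x in Ioi (1 : ℝ), periodicBernoulli m x * powDeriv s m x)) := by
    refine Tendsto.sub (Tendsto.sub (Tendsto.add ?_ tendsto_const_nhds) ?_)
      (Tendsto.const_mul _ ?_)
    · exact MeasureTheory.intervalIntegral_tendsto_integral_Ioi 1
        (integrableOn_powDeriv (by simpa using hs) zero_lt_one) tendsto_natCast_atTop_atTop
    · refine tendsto_finsetSum _ fun k _ => Tendsto.const_mul _ ?_
      simp only [sub_self]
      exact (tendsto_powDeriv_natCast (by linarith) k).const_mul _
    · exact MeasureTheory.intervalIntegral_tendsto_integral_Ioi 1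
        (integrableOn_periodicBernoulli_mul_powDeriv (by linarith) zero_lt_one)
        tendsto_natCast_atTop_atTop
  have heq := tendsto_nhds_unique (hsum.congr' (by
    filter_upwards [eventually_ge_atTop 1] with M hM
    exact sum_powDeriv_eq s hm hM le_rfl (by linarith))) hlim
  have hint : ∫ x in Ioi (1 : ℝ), powDeriv s 0 x = (s - 1)⁻¹ := by
    simp only [powDeriv_zero]
    rw [integral_Ioi_cpow_of_lt (by simpa using hs) zero_lt_one]
    simp only [Complex.ofReal_one, Complex.one_cpow]
    rw [neg_div, ← div_neg, one_div]
    congr 1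
    ring
  rw [riemannZeta_eq_inv_sub_add hs1, hint] at heq
  simp only [mul_zero, Finset.sum_const_zero, sub_zero] at heq
  rw [eulerMaclaurinConst]
  linear_combination -heq

/-- The remainder integral is a polynomial in `s` times the Mellin transform, at `1 - s - m`, of a
bounded function supported in `(1, ∞)`; the other terms are polynomials in `s`. -/
theorem differentiableAt_eulerMaclaurinConst {m : ℕ} {s : ℂ} (hs : 1 - (m : ℝ) < s.re) :
    DifferentiableAt ℂ (eulerMaclaurinConst m) s := by
  have hmel : ∀ z : ℂ, ∫ x in Ioi (1 : ℝ), periodicBernoulli m x * powDeriv z m x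
      = (∏ j ∈ Finset.range m, (-z - (j : ℂ))) *
        mellin ((Ioi (1 : ℝ)).indicator (periodicBernoulli m)) (1 - z - m) := by
    intro z
    rw [mellin, ← MeasureTheory.integral_const_mul]
    have : ∀ t : ℝ, (∏ j ∈ Finset.range m, (-z - (j : ℂ))) * ((t : ℂ) ^ (1 - z - m - 1) •
        (Ioi (1 : ℝ)).indicator (periodicBernoulli m) t)
        = (Ioi (1 : ℝ)).indicator (fun x => periodicBernoulli m x * powDeriv z m x) t := by
      intro t
      by_cases ht : t ∈ Ioi (1 : ℝ)
      · rw [indicator_of_mem ht, indicator_of_mem ht, powDeriv,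
          show 1 - z - m - 1 = -z - m by ring, smul_eq_mul]
        ring
      · simp [indicator_of_notMem ht]
    simp_rw [this]
    rw [MeasureTheory.setIntegral_indicator measurableSet_Ioi, Ioi_inter_Ioi]
    simp
  obtain ⟨C, -, hC⟩ := exists_norm_periodicBernoulli_le m
  have hdiff : DifferentiableAt ℂ
      (mellin ((Ioi (1 : ℝ)).indicator (periodicBernoulli m))) (1 - s - m) := by
    have hbound : ∀ x, ‖(Ioi (1 : ℝ)).indicator (periodicBernoulli m) x‖ ≤ C := fun x =>
      (norm_indicator_le_norm_self _ x).trans (hC x)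
    -- Boundedness at infinity is decay of order `a = 0`, which asks for `(1 - s - m).re < 0`. The
    -- function vanishes near `0`, so any `b` below the real part will do.
    refine mellin_differentiableAt_of_isBigO_rpow (a := 0) (b := (1 - s - m).re - 1) ?_ ?_ ?_ ?_ ?_
    · refine MeasureTheory.LocallyIntegrable.locallyIntegrableOn ?_ _
      refine (MeasureTheory.locallyIntegrable_const C).mono ?_ ?_
      · exact ((measurable_periodicBernoulli m).indicator measurableSet_Ioi).aestronglyMeasurable
      · exact Eventually.of_forall fun x => (hbound x).trans (le_abs_self C)
    · simp only [neg_zero, Real.rpow_zero]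
      exact IsBigO.of_bound C (Eventually.of_forall fun x => by simpa using hbound x)
    · simp
      linarith
    · refine IsBigO.of_bound 0 ?_
      filter_upwards [Ioo_mem_nhdsGT (zero_lt_one (α := ℝ))] with x hx
      rw [indicator_of_notMem (by simpa using hx.2.le)]
      simp
    · linarith
  have hprod : ∀ k : ℕ, Differentiable ℂ fun z : ℂ => ∏ j ∈ Finset.range k, (-z - (j : ℂ)) := by
    intro k
    fun_prop
  unfold eulerMaclaurinConst
  simp only [hmel, powDeriv_one_right]
  refine DifferentiableAt.sub (DifferentiableAt.add (hprod 0 s) ?_)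
    (DifferentiableAt.const_mul ((hprod m s).mul ?_) _)
  · refine DifferentiableAt.fun_sum fun k _ => ?_
    exact ((hprod k s).const_mul _).const_mul _
  · exact hdiff.comp s (f := fun z : ℂ => 1 - z - m) (by fun_prop)

/-- Identity theorem: both sides are holomorphic on a half-plane and agree near `2`. -/
theorem eulerMaclaurinConst_eq {m : ℕ} (hm : 1 ≤ m) {s : ℂ} (hs : 1 - (m : ℝ) < s.re) :
    eulerMaclaurinConst m s = riemannZeta₀ s := by
  have hm' : (1 : ℝ) ≤ m := by exact_mod_cast hm
  have hopen : IsOpen {z : ℂ | 1 - (m : ℝ) < z.re} := isOpen_lt continuous_const Complex.continuous_re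
  have h := AnalyticOnNhd.eqOn_of_preconnected_of_eventuallyEq (𝕜 := ℂ)
    (f := eulerMaclaurinConst m) (g := riemannZeta₀) (U := {z : ℂ | 1 - (m : ℝ) < z.re})
    (z₀ := 2)
    (DifferentiableOn.analyticOnNhd
      (fun z hz => (differentiableAt_eulerMaclaurinConst hz).differentiableWithinAt) hopen)
    (differentiable_riemannZeta₀.differentiableOn.analyticOnNhd hopen)
    (convex_halfSpace_re_gt _).isPreconnected (by simp; linarith)
    (by
      filter_upwards [(isOpen_lt continuous_const Complex.continuous_re).mem_nhds
        (show (1 : ℝ) < (2 : ℂ).re by norm_num)] with z hz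
      exact eulerMaclaurinConst_eq_of_one_lt hm hz)
  exact h hs

/-! ### Error bounds for the discrete sums -/

/-- The sum of `F` over all nonzero residues modulo `N`, repeated `N` times, where a residue
is measured by its distance to `0` on a circle of length `L`. -/
def discreteSum (L : ℝ) (F : ℝ → ℂ) (N : ℕ) : ℂ :=
  2 * N * (∑ n ∈ Finset.Icc 1 (N / 2), F (L / N * n)
    + normBernoulli 1 ((N % 2 : ℕ) / 2) * F (L / 2))

/-- The Bernoulli terms belonging to `discreteSum`, for a family `D` of derivatives. -/
def bernoulliTerms (L : ℝ) (D : ℕ → ℝ → ℂ) (p N : ℕ) : ℂ :=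
  2 * N * ∑ n ∈ Finset.Icc 1 p,
    normBernoulli (2 * n) ((N % 2 : ℕ) / 2) * ((L / N : ℝ) : ℂ) ^ (2 * n - 1) * D (2 * n - 1) (L / 2)

theorem natCast_half_add (N : ℕ) : (N : ℝ) / 2 = (N / 2 : ℕ) + ((N % 2 : ℕ) : ℝ) / 2 := by
  have : (N : ℝ) = 2 * (N / 2 : ℕ) + (N % 2 : ℕ) := by exact_mod_cast (Nat.div_add_mod N 2).symm
  linarith

theorem natCast_half_le (N : ℕ) : ((N / 2 : ℕ) : ℝ) ≤ (N : ℝ) / 2 := by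
  rw [natCast_half_add N]
  exact le_add_of_nonneg_right (by positivity)

theorem natCast_half_le_add_one (N : ℕ) : (N : ℝ) / 2 ≤ (N / 2 : ℕ) + 1 := by
  rw [natCast_half_add N]
  have : ((N % 2 : ℕ) : ℝ) ≤ 1 := by exact_mod_cast Nat.le_of_lt_succ (Nat.mod_lt N two_pos)
  linarith

theorem sum_range_normBernoulli_mul (p : ℕ) {κ : ℕ} (hκ : κ < 2) (u : ℕ → ℂ) :
    ∑ k ∈ Finset.range (2 * p + 1), (-1 : ℂ) ^ k * (normBernoulli (k + 1) ((κ : ℝ) / 2) * u k)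
      = normBernoulli 1 ((κ : ℝ) / 2) * u 0
        - ∑ n ∈ Finset.Icc 1 p, normBernoulli (2 * n) ((κ : ℝ) / 2) * u (2 * n - 1) := by
  induction p with
  | zero => simp
  | succ p ih =>
    rw [show 2 * (p + 1) + 1 = 2 * p + 1 + 1 + 1 by ring, Finset.sum_range_succ,
      Finset.sum_range_succ, ih, Finset.sum_Icc_succ_top (by omega),
      normBernoulli_odd_eq_zero (k := 2 * p + 1 + 1 + 1) ⟨p + 1, by ring⟩ (by omega) hκ,
      (odd_two_mul_add_one p).neg_one_pow]
    simp only [mul_add, mul_one, zero_mul, mul_zero, add_zero]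
    rw [show 2 * p + 2 - 1 = 2 * p + 1 by omega]
    ring

/-- With `σ = s.re` and `t = 2p`, the powers `n ^ σ` from the scaling and `n ^ (-σ)` from the
derivative cancel. Hence the rate in `discreteSum_powDeriv_sub_le` does not depend on `s`. -/
theorem rpow_scaling {L n σ t : ℝ} (hL : 0 < L) (hn : 0 < n) :
    n * (L / n) ^ (-σ) * (n / 2) ^ (-σ - t - 1)
      = L ^ (-σ) * 2 ^ (σ + t + 1) * n ^ (-t) := by
  rw [Real.div_rpow hL.le hn.le, Real.div_rpow hn.le two_pos.le,
    show σ + t + 1 = -(-σ - t - 1) by ring, Real.rpow_neg two_pos.le (-σ - t - 1)]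
  have h1 : n * n ^ (-σ - t - 1) = n ^ (-t) * n ^ (-σ) := by
    rw [← Real.rpow_add hn]
    nth_rw 1 [← Real.rpow_one n]
    rw [← Real.rpow_add hn]
    ring_nf
  have h2 : n ^ (-σ) ≠ 0 := (Real.rpow_pos_of_pos hn _).ne'
  have h3 : (2 : ℝ) ^ (-σ - t - 1) ≠ 0 := (Real.rpow_pos_of_pos two_pos _).ne'
  field_simp
  linear_combination h1

theorem norm_integral_Ioi_periodicBernoulli_mul_powDeriv_le {s : ℂ} {m : ℕ}
    (hs : 1 - (m : ℝ) < s.re) :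
    ∃ C, ∀ y : ℝ, 0 < y →
      ‖∫ x in Ioi y, periodicBernoulli m x * powDeriv s m x‖ ≤ C * y ^ (-s.re - m + 1) := by
  obtain ⟨B, -, hB⟩ := exists_norm_periodicBernoulli_le m
  set c := ‖∏ j ∈ Finset.range m, (-s - (j : ℂ))‖
  refine ⟨B * c * (-1 / (-s.re - m + 1)), fun y hy => ?_⟩
  have h1 : ∀ x ∈ Ioi y, ‖periodicBernoulli m x * powDeriv s m x‖
      ≤ B * c * x ^ (-s.re - (m : ℝ)) := by
    intro x hx
    rw [norm_mul, norm_powDeriv s m (hy.trans hx), mul_assoc]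
    exact mul_le_mul_of_nonneg_right (hB x)
      (mul_nonneg (norm_nonneg _) (Real.rpow_nonneg (hy.trans hx).le _))
  have h2 : MeasureTheory.IntegrableOn (fun x : ℝ => B * c * x ^ (-s.re - (m : ℝ))) (Ioi y) :=
    (integrableOn_Ioi_rpow_of_lt (by linarith) hy).const_mul _
  refine (MeasureTheory.norm_integral_le_of_norm_le h2
    (MeasureTheory.ae_restrict_of_forall_mem measurableSet_Ioi h1)).trans (le_of_eq ?_)
  rw [MeasureTheory.integral_const_mul, integral_Ioi_rpow_of_lt (by linarith) hy]
  ring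

/-- Order `2p + 2` gives convergence for `s.re > -(2p + 1)`, which includes the borderline exponent
`-2p`. What remains is the last boundary term, in the derivative of order `2p + 1`, and the tail
integral; both are of size `N ^ (-s.re - 2p - 1)` before the prefactor. -/
theorem discreteSum_powDeriv_sub_le {L : ℝ} (hL : 0 < L) {s : ℂ} {p : ℕ}
    (hs : -(2 * (p : ℝ) + 1) < s.re) :
    ∃ K, ∀ N : ℕ, 2 ≤ N →
      ‖discreteSum L (powDeriv s 0) N
        - 2 * N * ((L / N : ℝ) : ℂ) ^ (-s) *
          ((∫ x in (1 : ℝ)..(N : ℝ) / 2, powDeriv s 0 x) + riemannZeta₀ s)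
        - bernoulliTerms L (powDeriv s) p N‖ ≤ K * (N : ℝ) ^ (-(2 * (p : ℝ))) := by
  have hs' : 1 - ((2 * p + 2 : ℕ) : ℝ) < s.re := by push_cast; linarith
  obtain ⟨C, hC⟩ := norm_integral_Ioi_periodicBernoulli_mul_powDeriv_le hs'
  set c := ‖∏ j ∈ Finset.range (2 * p + 1), (-s - (j : ℂ))‖
  set b := ‖normBernoulli (2 * p + 2) 0‖ + ‖normBernoulli (2 * p + 2) (1 / 2)‖
  refine ⟨2 * (b * c + C) * (L ^ (-s.re) * 2 ^ (s.re + 2 * p + 1)), fun N hN => ?_⟩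
  have hN0 : (0 : ℝ) < N := by exact_mod_cast (by omega : 0 < N)
  have hM : 1 ≤ N / 2 := by omega
  have hκ : N % 2 < 2 := Nat.mod_lt N two_pos
  have hy : (N : ℝ) / 2 - (N / 2 : ℕ) = ((N % 2 : ℕ) : ℝ) / 2 := by
    rw [natCast_half_add N]; ring
  have hh : 0 < L / N := by positivity
  have hhy : L / N * ((N : ℝ) / 2) = L / 2 := by field_simp
  have em := sum_powDeriv_eq_add_const (m := 2 * p + 2) (by omega) hs' hM
    (natCast_half_le N) (natCast_half_le_add_one N)
  rw [hy, eulerMaclaurinConst_eq (by omega) hs', Finset.sum_range_succ _ (2 * p + 1),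
    sum_range_normBernoulli_mul p hκ (fun k => powDeriv s k ((N : ℝ) / 2))] at em
  have e1 : ∑ n ∈ Finset.Icc 1 (N / 2), powDeriv s 0 (L / N * n)
      = ((L / N : ℝ) : ℂ) ^ (-s) * ∑ n ∈ Finset.Icc 1 (N / 2), powDeriv s 0 n := by
    rw [Finset.mul_sum]
    refine Finset.sum_congr rfl fun n hn => ?_
    have : (0 : ℝ) < n := by exact_mod_cast (Finset.mem_Icc.1 hn).1
    simpa using powDeriv_mul s 0 hh this
  have e2 : ∀ k, ((L / N : ℝ) : ℂ) ^ k * powDeriv s k (L / 2)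
      = ((L / N : ℝ) : ℂ) ^ (-s) * powDeriv s k ((N : ℝ) / 2) := by
    intro k
    rw [← hhy]
    exact powDeriv_mul s k hh (by positivity)
  have e2' := e2 0
  rw [pow_zero, one_mul] at e2'
  have e3 : bernoulliTerms L (powDeriv s) p N = 2 * N * (((L / N : ℝ) : ℂ) ^ (-s) *
      ∑ n ∈ Finset.Icc 1 p, normBernoulli (2 * n) (((N % 2 : ℕ) : ℝ) / 2)
        * powDeriv s (2 * n - 1) ((N : ℝ) / 2)) := by
    rw [bernoulliTerms, Finset.mul_sum (a := ((L / N : ℝ) : ℂ) ^ (-s))]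
    congr 1
    refine Finset.sum_congr rfl fun n _ => ?_
    rw [mul_assoc, e2]
    ring
  have hdiff : discreteSum L (powDeriv s 0) N
        - 2 * N * ((L / N : ℝ) : ℂ) ^ (-s) *
          ((∫ x in (1 : ℝ)..(N : ℝ) / 2, powDeriv s 0 x) + riemannZeta₀ s)
        - bernoulliTerms L (powDeriv s) p N
      = 2 * N * ((L / N : ℝ) : ℂ) ^ (-s) *
        (normBernoulli (2 * p + 2) (((N % 2 : ℕ) : ℝ) / 2) * powDeriv s (2 * p + 1) ((N : ℝ) / 2)
          + ∫ x in Ioi ((N : ℝ) / 2),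
            periodicBernoulli (2 * p + 2) x * powDeriv s (2 * p + 2) x) := by
    rw [discreteSum, e1, e2', e3, em, (odd_two_mul_add_one p).neg_one_pow,
      Even.neg_one_pow (⟨p + 1, by ring⟩ : Even (2 * p + 2))]
    ring
  have hb : ‖normBernoulli (2 * p + 2) (((N % 2 : ℕ) : ℝ) / 2)‖ ≤ b := by
    rcases Nat.mod_two_eq_zero_or_one N with h | h <;> rw [h] <;> simp [b]
  have hy0 : (0 : ℝ) < N / 2 := by positivity
  have hr := hC _ hy0
  push_cast at hr
  rw [hdiff, norm_mul, norm_mul, norm_mul, Complex.norm_cpow_eq_rpow_re_of_pos hh]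
  simp only [Complex.norm_ofNat, Complex.norm_natCast, Complex.neg_re]
  calc 2 * (N : ℝ) * (L / N) ^ (-s.re) * _
      ≤ 2 * (N : ℝ) * (L / N) ^ (-s.re) * ((b * c + C) * ((N : ℝ) / 2) ^ (-s.re - 2 * p - 1)) := by
        refine mul_le_mul_of_nonneg_left ?_ (by positivity)
        refine (norm_add_le _ _).trans ?_
        rw [add_mul]
        refine add_le_add ?_ (hr.trans (le_of_eq ?_))
        · rw [norm_mul, norm_powDeriv s _ hy0, mul_assoc]
          refine mul_le_mul hb (le_of_eq ?_) (by positivity) (by positivity)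
          push_cast
          congr 2
          ring
        · ring_nf
    _ = 2 * (b * c + C) * ((N : ℝ) * (L / N) ^ (-s.re) * ((N : ℝ) / 2) ^ (-s.re - 2 * p - 1)) := by
        ring
    _ = _ := by rw [rpow_scaling hL hN0]; ring

/-- In the scaled variable the formula starts at `1`, that is at `h = L / N`, away from the
singularity. The missing integral over `[0, h]` and the lower boundary terms `h ^ k * g k h` are all
`O(h ^ α)`, and the factor `N` makes this `N ^ (1 - α)`. -/
theorem discreteSum_sub_le {L : ℝ} (hL : 0 < L) {g : ℕ → ℝ → ℂ} {p : ℕ} {α C : ℝ} (hα : -1 < α)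
    (hc : ∀ k ≤ 2 * p + 1, ContinuousOn (g k) (Ioc 0 (L / 2)))
    (hd : ∀ k < 2 * p + 1, ∀ x ∈ Ioo 0 (L / 2), HasDerivAt (g k) (g (k + 1) x) x)
    (hb : ∀ k ≤ 2 * p + 1, ∀ x ∈ Ioc 0 (L / 2), ‖g k x‖ ≤ C * x ^ (α - k))
    (hint : IntervalIntegrable (g 0) MeasureTheory.volume 0 (L / 2)) :
    ∃ K, 0 ≤ K ∧ ∀ N : ℕ, 2 ≤ N →
      ‖discreteSum L (g 0) N - 2 * N * ((L / N : ℝ) : ℂ)⁻¹ * (∫ x in (0 : ℝ)..L / 2, g 0 x)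
        - bernoulliTerms L g p N‖
      ≤ K * ((N : ℝ) ^ (1 - α) * (1 + ∫ x in (1 : ℝ)..(N : ℝ) / 2, x ^ (α - (2 * p + 1)))) := by
  obtain ⟨B, hB0, hB⟩ := exists_norm_periodicBernoulli_le (2 * p + 1)
  have hC : 0 ≤ C := by
    have h := (norm_nonneg _).trans (hb 0 (by omega) (L / 2) ⟨by positivity, le_rfl⟩)
    exact nonneg_of_mul_nonneg_left h (Real.rpow_pos_of_pos (by positivity) _)
  set b := ∑ k ∈ Finset.range (2 * p + 1), ‖normBernoulli (k + 1) 0‖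
  have hb0 : 0 ≤ b := Finset.sum_nonneg fun _ _ => norm_nonneg _
  have hα1 : 0 < α + 1 := by linarith
  -- `1 / (α + 1)` comes from the integral over `[0, h]`, `1 + b` from the lower boundary terms, `B`
  -- from the remainder integral, and `L ^ α` from `N * h ^ α`.
  refine ⟨2 * C * (1 / (α + 1) + 1 + b + B) * L ^ α, by positivity, fun N hN => ?_⟩
  have hN2 : (2 : ℝ) ≤ N := by exact_mod_cast hN
  have hN0 : (0 : ℝ) < N := by linarith
  have hM : 1 ≤ N / 2 := by omega
  have hκ : N % 2 < 2 := Nat.mod_lt N two_pos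
  have hy : (N : ℝ) / 2 - (N / 2 : ℕ) = ((N % 2 : ℕ) : ℝ) / 2 := by
    rw [natCast_half_add N]; ring
  obtain ⟨h, hh⟩ : ∃ h, h = L / N := ⟨_, rfl⟩
  have hh0 : 0 < h := by rw [hh]; positivity
  have hhy : h * ((N : ℝ) / 2) = L / 2 := by rw [hh]; field_simp
  have hhL : h ≤ L / 2 := by rw [← hhy]; nlinarith
  have hy1 : (1 : ℝ) ≤ N / 2 := by linarith
  have hmem : ∀ x ∈ Icc (1 : ℝ) (N / 2), h * x ∈ Ioc 0 (L / 2) := by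
    intro x hx
    refine ⟨mul_pos hh0 (by linarith [hx.1]), ?_⟩
    rw [← hhy]
    exact mul_le_mul_of_nonneg_left hx.2 hh0.le
  have hφc : ∀ k ≤ 2 * p + 1,
      ContinuousOn (fun x : ℝ => (h : ℂ) ^ k * g k (h * x)) (Icc 1 ((N : ℝ) / 2)) := fun k hk =>
    continuousOn_const.mul ((hc k hk).comp (by fun_prop) hmem)
  have em := sum_eq_integral_add_normBernoulli (φ := fun k x => (h : ℂ) ^ k * g k (h * x))
    (m := 2 * p + 1) (by omega) hM (natCast_half_le N) (natCast_half_le_add_one N) hφc (by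
      intro k hk x hx
      have hx' : h * x ∈ Ioo 0 (L / 2) := by
        refine ⟨mul_pos hh0 (by linarith [hx.1]), ?_⟩
        rw [← hhy]
        exact mul_lt_mul_of_pos_left hx.2 hh0
      have := ((hd k hk _ hx').scomp x ((hasDerivAt_id x).const_mul h)).const_mul ((h : ℂ) ^ k)
      refine this.congr_deriv ?_
      simp only [mul_one, Complex.real_smul]
      ring)
  rw [hy, sum_range_normBernoulli_mul p hκ
    (fun k => (h : ℂ) ^ k * g k (h * ((N : ℝ) / 2)))] at em
  simp only [pow_zero, one_mul, hhy, mul_one] at em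
  rw [intervalIntegral.integral_comp_mul_left _ hh0.ne', mul_one, hhy] at em
  have hi1 : IntervalIntegrable (g 0) MeasureTheory.volume 0 h :=
    hint.mono_set (by
      rw [uIcc_of_le hh0.le, uIcc_of_le (by positivity)]; exact Icc_subset_Icc_right hhL)
  have hi2 : IntervalIntegrable (g 0) MeasureTheory.volume h (L / 2) :=
    hint.mono_set (by
      rw [uIcc_of_le hhL, uIcc_of_le (by positivity)]; exact Icc_subset_Icc_left hh0.le)
  have hsplit := intervalIntegral.integral_add_adjacent_intervals hi1 hi2
  set J := ∫ x in (1 : ℝ)..(N : ℝ) / 2, x ^ (α - (2 * p + 1))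
  have hJ : 0 ≤ J := intervalIntegral.integral_nonneg hy1 fun x hx =>
    Real.rpow_nonneg (by linarith [hx.1]) _
  have hhα : 0 ≤ h ^ α := Real.rpow_nonneg hh0.le _
  have b1 : ‖(h : ℂ)⁻¹ * ∫ x in (0 : ℝ)..h, g 0 x‖ ≤ C * (1 / (α + 1)) * h ^ α := by
    have hI : ‖∫ x in (0 : ℝ)..h, g 0 x‖ ≤ ∫ x in (0 : ℝ)..h, C * x ^ α := by
      refine intervalIntegral.norm_integral_le_of_norm_le hh0.le (Eventually.of_forall fun x hx => ?_)
        ((intervalIntegral.intervalIntegrable_rpow' hα).const_mul C)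
      simpa using hb 0 (by omega) x ⟨hx.1, hx.2.trans hhL⟩
    rw [intervalIntegral.integral_const_mul, integral_rpow (Or.inl hα), Real.zero_rpow hα1.ne',
      sub_zero, Real.rpow_add_one hh0.ne'] at hI
    rw [norm_mul, norm_inv, Complex.norm_real, Real.norm_of_nonneg hh0.le]
    calc h⁻¹ * _ ≤ h⁻¹ * (C * (h ^ α * h / (α + 1))) :=
          mul_le_mul_of_nonneg_left hI (by positivity)
      _ = _ := by field_simp
  have hgh : ∀ k ≤ 2 * p + 1, ‖(h : ℂ) ^ k * g k h‖ ≤ C * h ^ α := by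
    intro k hk
    rw [norm_mul, norm_pow, Complex.norm_real, Real.norm_of_nonneg hh0.le]
    calc h ^ k * _ ≤ h ^ k * (C * h ^ (α - k)) :=
          mul_le_mul_of_nonneg_left (hb k hk h ⟨hh0, hhL⟩) (by positivity)
      _ = _ := by
          rw [Real.rpow_sub hh0, Real.rpow_natCast]
          field_simp
  have b2 : ‖g 0 h + ∑ k ∈ Finset.range (2 * p + 1),
      (-1 : ℂ) ^ k * (normBernoulli (k + 1) 0 * ((h : ℂ) ^ k * g k h))‖
      ≤ C * (1 + b) * h ^ α := by
    refine (norm_add_le _ _).trans ?_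
    have t1 : ‖g 0 h‖ ≤ C * h ^ α := by simpa using hgh 0 (by omega)
    have t2 : ‖∑ k ∈ Finset.range (2 * p + 1),
        (-1 : ℂ) ^ k * (normBernoulli (k + 1) 0 * ((h : ℂ) ^ k * g k h))‖ ≤ b * (C * h ^ α) := by
      rw [Finset.sum_mul]
      refine norm_sum_le_of_le _ fun k hk => ?_
      rw [norm_mul, norm_pow, norm_neg, norm_one, one_pow, one_mul, norm_mul]
      exact mul_le_mul_of_nonneg_left (hgh k (Finset.mem_range.1 hk).le) (norm_nonneg _)
    linarith
  have b3 : ‖∫ x in (1 : ℝ)..(N : ℝ) / 2, periodicBernoulli (2 * p + 1) x *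
      ((h : ℂ) ^ (2 * p + 1) * g (2 * p + 1) (h * x))‖ ≤ C * B * h ^ α * J := by
    rw [← intervalIntegral.integral_const_mul]
    refine intervalIntegral.norm_integral_le_of_norm_le hy1 (Eventually.of_forall fun x hx => ?_) ?_
    · have hx0 : 0 < x := by linarith [hx.1]
      have hg := hb (2 * p + 1) le_rfl (h * x) (hmem x ⟨hx.1.le, hx.2⟩)
      rw [norm_mul, norm_mul, norm_pow, Complex.norm_real, Real.norm_of_nonneg hh0.le]
      calc _ ≤ B * (h ^ (2 * p + 1) * (C * (h * x) ^ (α - (2 * p + 1 : ℕ)))) :=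
            mul_le_mul (hB x) (mul_le_mul_of_nonneg_left hg (by positivity)) (by positivity) hB0
        _ = _ := by
            rw [Real.mul_rpow hh0.le hx0.le, Real.rpow_sub hh0, Real.rpow_natCast]
            push_cast
            field_simp
    · refine ContinuousOn.intervalIntegrable_of_Icc hy1 (continuousOn_const.mul ?_)
      exact continuousOn_id.rpow_const fun x hx => Or.inl (by
        simp only [id]; linarith [hx.1])
  have hdiff : discreteSum L (g 0) N
        - 2 * N * ((L / N : ℝ) : ℂ)⁻¹ * (∫ x in (0 : ℝ)..L / 2, g 0 x) - bernoulliTerms L g p N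
      = 2 * N * (-((h : ℂ)⁻¹ * ∫ x in (0 : ℝ)..h, g 0 x)
        + (g 0 h + ∑ k ∈ Finset.range (2 * p + 1),
            (-1 : ℂ) ^ k * (normBernoulli (k + 1) 0 * ((h : ℂ) ^ k * g k h)))
        + ∫ x in (1 : ℝ)..(N : ℝ) / 2, periodicBernoulli (2 * p + 1) x *
            ((h : ℂ) ^ (2 * p + 1) * g (2 * p + 1) (h * x))) := by
    rw [discreteSum, bernoulliTerms, ← hh, em, ← hsplit, (odd_two_mul_add_one p).neg_one_pow]
    simp only [mul_assoc, Complex.real_smul, Complex.ofReal_inv]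
    ring
  rw [hdiff, norm_mul, norm_mul, Complex.norm_ofNat, Complex.norm_natCast]
  have hscale : (N : ℝ) * h ^ α = L ^ α * (N : ℝ) ^ (1 - α) := by
    rw [hh, Real.div_rpow hL.le hN0.le, Real.rpow_sub hN0, Real.rpow_one]
    ring
  calc _ ≤ 2 * (N : ℝ) * (C * (1 / (α + 1)) * h ^ α + C * (1 + b) * h ^ α
          + C * B * h ^ α * J) := by
        refine mul_le_mul_of_nonneg_left ?_ (by positivity)
        refine (norm_add₃_le).trans ?_
        rw [norm_neg]
        linarith
    _ = 2 * C * ((1 / (α + 1) + 1 + b) + B * J) * (N * h ^ α) := by ring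
    _ ≤ 2 * C * ((1 / (α + 1) + 1 + b + B) * (1 + J)) * (N * h ^ α) := by
        refine mul_le_mul_of_nonneg_right (mul_le_mul_of_nonneg_left ?_ (by positivity))
          (by positivity)
        have : 0 ≤ (1 / (α + 1) + 1 + b) * J := by positivity
        nlinarith
    _ = _ := by rw [hscale]; ring

/-! ### Arc length along the curve -/

namespace RiemannianCircle

variable {d : ℕ} (Γ : RiemannianCircle d)

/-- The length of the part of the curve up to the parameter `t`. -/
def lengthTo (t : ℝ) : ℝ := (eVariationOn Γ.param (Icc 0 t)).toReal

theorem eVariationOn_Icc_ne_top {u v : ℝ} (hu : 0 ≤ u) (hv : v ≤ 1) :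
    eVariationOn Γ.param (Icc u v) ≠ ⊤ :=
  ne_top_of_le_ne_top Γ.rectifiable (eVariationOn.mono _ (Icc_subset_Icc hu hv))

theorem lengthTo_one : Γ.lengthTo 1 = Γ.length := rfl

theorem toReal_eVariationOn_Icc {u v : ℝ} (hu : 0 ≤ u) (huv : u ≤ v) (hv : v ≤ 1) :
    (eVariationOn Γ.param (Icc u v)).toReal = Γ.lengthTo v - Γ.lengthTo u := by
  have h := eVariationOn.Icc_add_Icc Γ.param (s := univ) hu huv (mem_univ u)
  simp only [univ_inter] at h
  rw [lengthTo, lengthTo, ← h, ENNReal.toReal_add (Γ.eVariationOn_Icc_ne_top le_rfl (huv.trans hv))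
    (Γ.eVariationOn_Icc_ne_top hu hv)]
  ring

/-- Zero variation would give equal endpoints, against injectivity; `v < 1` matters because the
curve closes up at `1`. -/
theorem lengthTo_lt {u v : ℝ} (hu : 0 ≤ u) (huv : u < v) (hv : v < 1) :
    Γ.lengthTo u < Γ.lengthTo v := by
  rw [← sub_pos, ← Γ.toReal_eVariationOn_Icc hu huv.le hv.le]
  refine ENNReal.toReal_pos (fun h => ?_) (Γ.eVariationOn_Icc_ne_top hu hv.le)
  have h1 := (eVariationOn.edist_le Γ.param (left_mem_Icc.2 huv.le) (right_mem_Icc.2 huv.le)).trans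
    h.le
  have h2 := Γ.injOn ⟨hu, huv.trans hv⟩ ⟨hu.trans huv.le, hv⟩ (edist_eq_zero.1 (le_antisymm h1 bot_le))
  exact huv.ne h2

theorem lengthTo_mono {u v : ℝ} (hu : 0 ≤ u) (huv : u ≤ v) (hv : v ≤ 1) :
    Γ.lengthTo u ≤ Γ.lengthTo v := by
  rw [← sub_nonneg, ← Γ.toReal_eVariationOn_Icc hu huv hv]
  exact ENNReal.toReal_nonneg

theorem lengthTo_nonneg (t : ℝ) : 0 ≤ Γ.lengthTo t := ENNReal.toReal_nonneg

theorem lengthTo_lt_length {u : ℝ} (hu : 0 ≤ u) (hu1 : u < 1) : Γ.lengthTo u < Γ.length := by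
  obtain ⟨v, h1, h2⟩ := exists_between hu1
  exact (Γ.lengthTo_lt hu h1 h2).trans_le (Γ.lengthTo_mono (hu.trans h1.le) h2.le le_rfl)

theorem length_pos : 0 < Γ.length :=
  (Γ.lengthTo_nonneg 0).trans_lt (Γ.lengthTo_lt_length le_rfl one_pos)

variable {Γ}

theorem coord_mem {x : EuclideanSpace ℝ (Fin d)} (hx : x ∈ Γ.carrier) : Γ.coord x ∈ Ico (0 : ℝ) 1 :=
  Function.invFunOn_mem hx

theorem arcLength_mem_Ico {x y : EuclideanSpace ℝ (Fin d)} (hx : x ∈ Γ.carrier)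
    (hy : y ∈ Γ.carrier) : Γ.arcLength x y ∈ Ico 0 Γ.length := by
  obtain ⟨hx0, hx1⟩ := coord_mem hx
  obtain ⟨hy0, hy1⟩ := coord_mem hy
  have hxn := Γ.lengthTo_nonneg (Γ.coord x)
  have hyl := Γ.lengthTo_lt_length hy0 hy1
  rw [arcLength]
  split_ifs with h
  · rw [Γ.toReal_eVariationOn_Icc hx0 h hy1.le]
    exact ⟨sub_nonneg.2 (Γ.lengthTo_mono hx0 h hy1.le), by linarith⟩
  · rw [not_le] at h
    have hlt := Γ.lengthTo_lt hy0 h hx1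
    rw [Γ.toReal_eVariationOn_Icc hx0 hx1.le le_rfl, lengthTo_one, ← lengthTo]
    have := Γ.lengthTo_lt_length hx0 hx1
    exact ⟨by linarith [Γ.lengthTo_nonneg (Γ.coord y)], by linarith⟩

/-- Working modulo `Γ.length` removes the case distinction at the base point. The representative is
recovered at the end from `arcLength_mem_Ico`. -/
theorem exists_arcLength_eq {x y : EuclideanSpace ℝ (Fin d)} (hx : x ∈ Γ.carrier)
    (hy : y ∈ Γ.carrier) :
    ∃ n : ℤ, Γ.arcLength x y = Γ.lengthTo (Γ.coord y) - Γ.lengthTo (Γ.coord x) + n * Γ.length := by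
  obtain ⟨hx0, hx1⟩ := coord_mem hx
  obtain ⟨hy0, hy1⟩ := coord_mem hy
  rw [arcLength]
  split_ifs with h
  · exact ⟨0, by rw [Γ.toReal_eVariationOn_Icc hx0 h hy1.le]; simp⟩
  · refine ⟨1, ?_⟩
    rw [Γ.toReal_eVariationOn_Icc hx0 hx1.le le_rfl, lengthTo_one, ← lengthTo]
    push_cast
    ring

theorem eq_of_mem_Ico_of_sub_eq {L x y : ℝ} (hx : x ∈ Ico 0 L) (hy : y ∈ Ico 0 L) {n : ℤ}
    (h : x = y + n * L) : x = y := by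
  have hL : 0 < L := hx.1.trans_lt hx.2
  have h1 : (n : ℝ) < 1 := by
    by_contra! hn
    nlinarith [hx.2, hy.1]
  have h2 : (-1 : ℝ) < n := by
    by_contra! hn
    nlinarith [hx.1, hy.2]
  have h3 : n < 1 := by exact_mod_cast h1
  have h4 : -1 < n := by exact_mod_cast h2
  obtain rfl : n = 0 := by omega
  simpa using h

theorem exists_lengthTo_eq {N : ℕ} {z : Fin N → EuclideanSpace ℝ (Fin d)}
    (hz : Γ.IsEquallySpaced z) (hN : 0 < N) (k : ℕ) (hk : k < N) :
    ∃ n : ℤ, Γ.lengthTo (Γ.coord (z ⟨k, hk⟩)) =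
      Γ.lengthTo (Γ.coord (z ⟨0, hN⟩)) + k * (Γ.length / N) + n * Γ.length := by
  induction k with
  | zero => exact ⟨0, by simp⟩
  | succ k ih =>
    obtain ⟨n, hn⟩ := ih (by omega)
    obtain ⟨n', hn'⟩ := exists_arcLength_eq (hz.1 ⟨k, by omega⟩) (hz.1 ⟨k + 1, hk⟩)
    rw [hz.2 ⟨k, by omega⟩ ⟨k + 1, hk⟩ rfl] at hn'
    refine ⟨n - n', ?_⟩
    push_cast
    linear_combination hn - hn'

theorem arcLength_eq_sub_val {N : ℕ} [NeZero N] {z : Fin N → EuclideanSpace ℝ (Fin d)}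
    (hz : Γ.IsEquallySpaced z) (j k : Fin N) :
    Γ.arcLength (z j) (z k) = Γ.length / N * ((k - j : Fin N) : ℕ) := by
  have hN : 0 < N := NeZero.pos N
  have hN' : (N : ℝ) ≠ 0 := by exact_mod_cast hN.ne'
  have hL := Γ.length_pos
  obtain ⟨n1, h1⟩ := exists_lengthTo_eq hz hN j j.2
  obtain ⟨n2, h2⟩ := exists_lengthTo_eq hz hN k k.2
  obtain ⟨n3, h3⟩ := exists_arcLength_eq (hz.1 j) (hz.1 k)
  -- Subtraction in `Fin N` is modulo `N`; the multiple of `N` turns into a multiple of `Γ.length`.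
  obtain ⟨n4, h4⟩ : ∃ n : ℤ, (((k - j : Fin N) : ℕ) : ℝ) = k - j + n * N := by
    rcases le_or_gt j k with h | h
    · refine ⟨0, ?_⟩
      rw [Fin.sub_val_of_le h, Nat.cast_sub (Fin.le_def.1 h)]
      simp
    · refine ⟨1, ?_⟩
      rw [Fin.coe_sub_iff_lt.2 h, Nat.cast_sub (by have := j.2; omega)]
      push_cast
      ring
  refine eq_of_mem_Ico_of_sub_eq (n := n3 + n2 - n1 - n4) (arcLength_mem_Ico (hz.1 j) (hz.1 k)) ?_ ?_
  · refine ⟨by positivity, ?_⟩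
    have : (((k - j : Fin N) : ℕ) : ℝ) < N := by exact_mod_cast (k - j).2
    calc Γ.length / N * _ < Γ.length / N * N := mul_lt_mul_of_pos_left this (by positivity)
      _ = Γ.length := by field_simp
  · rw [h3, h4, show Γ.coord (z k) = Γ.coord (z ⟨k, k.2⟩) from rfl,
      show Γ.coord (z j) = Γ.coord (z ⟨j, j.2⟩) from rfl, h1, h2]
    push_cast
    field_simp
    ring

theorem geodesicDist_eq {N : ℕ} [NeZero N] {z : Fin N → EuclideanSpace ℝ (Fin d)}
    (hz : Γ.IsEquallySpaced z) {j k : Fin N} (hjk : k ≠ j) :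
    Γ.geodesicDist (z j) (z k) =
      Γ.length / N * (min ((k - j : Fin N) : ℕ) (N - ((k - j : Fin N) : ℕ)) : ℕ) := by
  have hL := Γ.length_pos
  have h : ((j - k : Fin N) : ℕ) = N - ((k - j : Fin N) : ℕ) := by
    have h1 : ((k - j : Fin N) : ℕ) ≠ 0 := fun h0 =>
      hjk (sub_eq_zero.1 (Fin.ext (by simpa using h0)))
    rw [← neg_sub k j, Fin.val_neg, if_neg (fun h0 => h1 (Fin.ext_iff.1 h0))]
  rw [geodesicDist, arcLength_eq_sub_val hz, arcLength_eq_sub_val hz, h, Nat.cast_min,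
    mul_min_of_nonneg _ _ (by positivity)]

end RiemannianCircle

/-! ### Reduction of the energy to a discrete sum -/

/-- For even `N` the index `N / 2` is its own mirror image, and `B_1(0) = -1/2` removes its second
copy. For odd `N` the pairing is perfect and `B_1(1/2) = 0`. -/
theorem sum_Ico_min_reflect (u : ℕ → ℂ) {N : ℕ} (hN : 2 ≤ N) :
    ∑ m ∈ Finset.Ico 1 N, u (min m (N - m)) =
      2 * (∑ m ∈ Finset.Icc 1 (N / 2), u m + normBernoulli 1 ((N % 2 : ℕ) / 2) * u (N / 2)) := by
  obtain ⟨M, hM⟩ : ∃ M, M = N / 2 := ⟨_, rfl⟩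
  have hIcc : Finset.Icc 1 M = Finset.Ico 1 (M + 1) := by ext; simp
  rw [normBernoulli_one, ← hM, hIcc]
  rcases Nat.mod_two_eq_zero_or_one N with h | h
  · obtain rfl : N = 2 * M := by omega
    rw [← Finset.sum_Ico_consecutive _ (show 1 ≤ M + 1 by omega) (show M + 1 ≤ 2 * M by omega)]
    have e1 : ∑ m ∈ Finset.Ico 1 (M + 1), u (min m (2 * M - m)) = ∑ m ∈ Finset.Ico 1 (M + 1), u m :=
      Finset.sum_congr rfl fun m hm => by
        rw [Finset.mem_Ico] at hm; rw [min_eq_left (by omega)]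
    have e2 : ∑ m ∈ Finset.Ico (M + 1) (2 * M), u (min m (2 * M - m))
        = ∑ m ∈ Finset.Ico (M + 1) (2 * M), u (2 * M - m) :=
      Finset.sum_congr rfl fun m hm => by
        rw [Finset.mem_Ico] at hm; rw [min_eq_right (by omega)]
    rw [e1, e2, Finset.sum_Ico_reflect u (M + 1) (show 2 * M ≤ 2 * M + 1 by omega),
      show 2 * M + 1 - 2 * M = 1 by omega, show 2 * M + 1 - (M + 1) = M by omega,
      Finset.sum_Ico_succ_top (by omega), h]
    push_cast
    ring
  · obtain rfl : N = 2 * M + 1 := by omega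
    rw [← Finset.sum_Ico_consecutive _ (show 1 ≤ M + 1 by omega) (show M + 1 ≤ 2 * M + 1 by omega)]
    have e1 : ∑ m ∈ Finset.Ico 1 (M + 1), u (min m (2 * M + 1 - m))
        = ∑ m ∈ Finset.Ico 1 (M + 1), u m :=
      Finset.sum_congr rfl fun m hm => by
        rw [Finset.mem_Ico] at hm; rw [min_eq_left (by omega)]
    have e2 : ∑ m ∈ Finset.Ico (M + 1) (2 * M + 1), u (min m (2 * M + 1 - m))
        = ∑ m ∈ Finset.Ico (M + 1) (2 * M + 1), u (2 * M + 1 - m) :=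
      Finset.sum_congr rfl fun m hm => by
        rw [Finset.mem_Ico] at hm; rw [min_eq_right (by omega)]
    rw [e1, e2, Finset.sum_Ico_reflect u (M + 1) (show 2 * M + 1 ≤ 2 * M + 1 + 1 by omega),
      show 2 * M + 1 + 1 - (2 * M + 1) = 1 by omega,
      show 2 * M + 1 + 1 - (M + 1) = M + 1 by omega, h]
    push_cast
    ring

theorem RiemannianCircle.energy_eq_discreteSum {d : ℕ} (Γ : RiemannianCircle d) (f : ℝ → ℂ) {N : ℕ}
    (hN : 2 ≤ N) {z : Fin N → EuclideanSpace ℝ (Fin d)} (hz : Γ.IsEquallySpaced z) :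
    Γ.energy f z = discreteSum Γ.length f N := by
  have : NeZero N := ⟨by omega⟩
  have hN0 : (N : ℝ) ≠ 0 := by exact_mod_cast (by omega : N ≠ 0)
  set u : ℕ → ℂ := fun m => f (Γ.length / N * m)
  have inner : ∀ j : Fin N, ∑ k ∈ Finset.univ.filter (fun k => k ≠ j),
      f (Γ.geodesicDist (z j) (z k)) = ∑ m ∈ Finset.Ico 1 N, u (min m (N - m)) := by
    intro j
    calc _ = ∑ k : Fin N, if ((k - j : Fin N) : ℕ) ≠ 0 then
          u (min ((k - j : Fin N) : ℕ) (N - ((k - j : Fin N) : ℕ))) else 0 := by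
          rw [Finset.sum_filter]
          refine Finset.sum_congr rfl fun k _ => ?_
          have hiff : k ≠ j ↔ ((k - j : Fin N) : ℕ) ≠ 0 := by
            rw [← sub_ne_zero, ne_eq, ne_eq, Fin.ext_iff, Fin.val_zero]
          by_cases hk : k ≠ j
          · rw [if_pos hk, if_pos (hiff.1 hk), geodesicDist_eq hz hk]
          · rw [if_neg hk, if_neg (fun h => hk (hiff.2 h))]
      _ = ∑ i : Fin N, if (i : ℕ) ≠ 0 then u (min (i : ℕ) (N - i)) else 0 :=
          Fintype.sum_equiv (Equiv.subRight j) _ _ fun _ => rfl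
      _ = ∑ m ∈ Finset.range N, if m ≠ 0 then u (min m (N - m)) else 0 :=
          Fin.sum_univ_eq_sum_range (fun m => if m ≠ 0 then u (min m (N - m)) else 0) N
      _ = _ := by
          rw [← Finset.sum_filter]
          refine Finset.sum_congr ?_ fun _ _ => rfl
          ext m
          simp
          omega
  -- The integer quotient `N / 2` hits the antipodal distance only for even `N`; for odd `N` the
  -- coefficient is zero.
  have hlast : normBernoulli 1 ((N % 2 : ℕ) / 2) * u (N / 2)
      = normBernoulli 1 ((N % 2 : ℕ) / 2) * f (Γ.length / 2) := by
    rcases Nat.mod_two_eq_zero_or_one N with h | h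
    · have h2 : (N : ℝ) / 2 = (N / 2 : ℕ) := by rw [natCast_half_add N, h]; simp
      simp only [u]
      rw [← h2]
      congr 2
      field_simp
    · rw [h, normBernoulli_one]
      norm_num
  rw [energy, Finset.sum_congr rfl fun j _ => inner j, Finset.sum_const, Finset.card_univ,
    Fintype.card_fin, nsmul_eq_mul, sum_Ico_min_reflect u hN, hlast, discreteSum]
  ring

/-! ### Main terms of the expansion -/

theorem integral_powDeriv_of_ne_one {s : ℂ} (hs : s ≠ 1) {y : ℝ} (hy : 1 ≤ y) :
    ∫ x in (1 : ℝ)..y, powDeriv s 0 x = ((y : ℂ) ^ (1 - s) - 1) / (1 - s) := by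
  simp only [powDeriv_zero]
  rw [integral_cpow (Or.inr ⟨fun h => hs (neg_injective h), fun h => ?_⟩),
    show -s + 1 = 1 - s by ring]
  · simp
  · rw [uIcc_of_le hy] at h
    linarith [h.1]

theorem integral_powDeriv_one {y : ℝ} (hy : 1 ≤ y) :
    ∫ x in (1 : ℝ)..y, powDeriv 1 0 x = (Real.log y : ℂ) := by
  simp only [powDeriv_zero, Complex.cpow_neg_one, ← Complex.ofReal_inv]
  rw [intervalIntegral.integral_ofReal, integral_inv_of_pos one_pos (by linarith), div_one]

/-- The lower limit of the integral contributes `-1 / (1 - s)`, exactly the pole part that completes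
`riemannZeta₀ s` to `ζ(s)`; the upper limit gives the `N ^ 2` term. -/
theorem power_main_term {L : ℝ} (hL : 0 < L) {s : ℂ} (hs : s ≠ 1) {N : ℕ} (hN : 2 ≤ N) :
    2 * N * ((L / N : ℝ) : ℂ) ^ (-s) *
        ((∫ x in (1 : ℝ)..(N : ℝ) / 2, powDeriv s 0 x) + riemannZeta₀ s)
      = 2 / (L : ℂ) * (N : ℂ) ^ 2 * (((L / 2 : ℝ) : ℂ) ^ (1 - s) / (1 - s))
        + 2 * riemannZeta s / (L : ℂ) ^ s * (N : ℂ) ^ (1 + s) := by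
  have hN2 : (2 : ℝ) ≤ N := by exact_mod_cast hN
  have hN0 : (0 : ℝ) < N := by linarith
  have hNc : (N : ℂ) ≠ 0 := by exact_mod_cast hN0.ne'
  obtain ⟨h, hh⟩ : ∃ h, h = L / N := ⟨_, rfl⟩
  have hh0 : 0 < h := by rw [hh]; positivity
  have hhc : (h : ℂ) ≠ 0 := by exact_mod_cast hh0.ne'
  have hLh : L = h * N := by rw [hh]; field_simp
  have hs1 : 1 - s ≠ 0 := sub_ne_zero.2 hs.symm
  have hs2 : s - 1 ≠ 0 := sub_ne_zero.2 hs
  have e1 : ((L / 2 : ℝ) : ℂ) ^ (1 - s)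
      = h * (h : ℂ) ^ (-s) * (((N : ℝ) / 2 : ℝ) : ℂ) ^ (1 - s) := by
    rw [show L / 2 = h * ((N : ℝ) / 2) by rw [hLh]; ring, Complex.ofReal_mul,
      Complex.mul_cpow_ofReal_nonneg hh0.le (by positivity), sub_eq_add_neg,
      Complex.cpow_add _ _ hhc, Complex.cpow_one]
  have e2 : (L : ℂ) ^ s = (h : ℂ) ^ s * (N : ℂ) ^ s := by
    rw [hLh, Complex.ofReal_mul, Complex.mul_cpow_ofReal_nonneg hh0.le hN0.le,
      Complex.ofReal_natCast]
  have hn1 : (N : ℂ) ^ s ≠ 0 := by simp [Complex.cpow_eq_zero_iff, hNc]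
  have hn2 : (h : ℂ) ^ s ≠ 0 := by simp [Complex.cpow_eq_zero_iff, hhc]
  rw [integral_powDeriv_of_ne_one hs (by linarith), e1, e2, riemannZeta_eq_inv_sub_add hs, ← hh,
    Complex.cpow_add _ _ hNc, Complex.cpow_one, Complex.cpow_neg, hLh]
  push_cast
  have hz : (s - 1)⁻¹ = -(1 / (1 - s)) := by
    rw [← neg_sub 1 s, inv_neg, one_div]
  rw [hz]
  field_simp
  ring

theorem exceptional_main_term {L : ℝ} (hL : 0 < L) {N : ℕ} (hN : 2 ≤ N) :
    2 * N * ((L / N : ℝ) : ℂ) ^ (-1 : ℂ) *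
        ((∫ x in (1 : ℝ)..(N : ℝ) / 2, powDeriv 1 0 x) + riemannZeta₀ 1)
      = 2 / (L : ℂ) * (N : ℂ) ^ 2 * ((Real.log N : ℝ) : ℂ)
        - 2 / (L : ℂ) * (N : ℂ) ^ 2 *
          ((Real.log 2 - Real.eulerMascheroniConstant : ℝ) : ℂ) := by
  have hN2 : (2 : ℝ) ≤ N := by exact_mod_cast hN
  have hN0 : (N : ℝ) ≠ 0 := by linarith
  have hNc : (N : ℂ) ≠ 0 := by exact_mod_cast hN0
  have hLc : (L : ℂ) ≠ 0 := by exact_mod_cast hL.ne'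
  rw [integral_powDeriv_one (by linarith), riemannZeta₀_one, Complex.cpow_neg_one,
    Real.log_div hN0 two_ne_zero]
  push_cast
  field_simp
  ring

/-! ### Splitting the kernel into powers and a regular part -/

theorem iteratedDerivWithin_eq_of_hasDerivWithinAt {D : ℕ → ℝ → ℂ} {I : Set ℝ} {m : ℕ}
    (hI : UniqueDiffOn ℝ I)
    (hD : ∀ k < m, ∀ x ∈ I, HasDerivWithinAt (D k) (D (k + 1) x) I x) :
    ∀ k ≤ m, EqOn (iteratedDerivWithin k (D 0) I) (D k) I := by
  intro k
  induction k with
  | zero => intro _ x _; simp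
  | succ k ih =>
    intro hk x hx
    rw [iteratedDerivWithin_succ, derivWithin_congr (ih (by omega)) (ih (by omega) hx)]
    exact (hD k (by omega) x hx).derivWithin (hI x hx)

theorem contDiffOn_of_hasDerivWithinAt_family {D : ℕ → ℝ → ℂ} {I : Set ℝ}
    (hI : UniqueDiffOn ℝ I)
    (hD : ∀ k, ∀ x ∈ I, HasDerivWithinAt (D k) (D (k + 1) x) I x) (m : ℕ) :
    ContDiffOn ℝ m (D 0) I := by
  have h : ContDiffOn ℝ ((m : ℕ∞) : WithTop ℕ∞) (D 0) I :=
    contDiffOn_of_differentiableOn_deriv fun k _ =>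
      DifferentiableOn.congr (fun x hx => (hD k x hx).differentiableWithinAt)
        (iteratedDerivWithin_eq_of_hasDerivWithinAt hI (fun j _ => hD j) k le_rfl)
  exact_mod_cast h

/-- The `k`-th derivative of `powerSum a s` on the positive reals. -/
def powerSumDeriv {q : ℕ} (a s : Fin (q + 1) → ℂ) (k : ℕ) (x : ℝ) : ℂ :=
  ∑ n, a n * powDeriv (s n) k x

theorem powerSumDeriv_zero {q : ℕ} (a s : Fin (q + 1) → ℂ) :
    powerSumDeriv a s 0 = powerSum a s := by
  ext x
  simp [powerSumDeriv, powerSum, powDeriv_zero]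

theorem hasDerivAt_powerSumDeriv {q : ℕ} (a s : Fin (q + 1) → ℂ) (k : ℕ) {x : ℝ} (hx : 0 < x) :
    HasDerivAt (powerSumDeriv a s k) (powerSumDeriv a s (k + 1) x) x :=
  HasDerivAt.fun_sum fun n _ => (hasDerivAt_powDeriv (s n) k hx).const_mul (a n)

/-- The asymptotic bound covers a neighbourhood of `0`, and compactness covers the rest of the
interval. -/
theorem exists_norm_le_rpow {u : ℝ → ℂ} {R β : ℝ} (hu : ContinuousOn u (Ioc 0 R))
    (hO : u =O[𝓝[>] 0] fun x : ℝ => x ^ β) :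
    ∃ C, 0 ≤ C ∧ ∀ x ∈ Ioc 0 R, ‖u x‖ ≤ C * x ^ β := by
  obtain ⟨C₁, hC₁⟩ := hO.bound
  obtain ⟨ε, hε, hεs⟩ := mem_nhdsGT_iff_exists_Ioo_subset.1 hC₁
  have hε0 : (0 : ℝ) < ε := hε
  have hpos : ∀ x ∈ Icc ε R, 0 < x := fun x hx => hε0.trans_le hx.1
  obtain ⟨C₂, hC₂⟩ := (isCompact_Icc (a := ε) (b := R)).exists_bound_of_continuousOn
    (f := fun x => u x * ((x ^ (-β) : ℝ) : ℂ))
    ((hu.mono fun x hx => ⟨hpos x hx, hx.2⟩).mul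
      (Complex.continuous_ofReal.comp_continuousOn
        (continuousOn_id.rpow_const fun x hx => Or.inl (hpos x hx).ne')))
  refine ⟨max 0 (max C₁ C₂), le_max_left _ _, fun x hx => ?_⟩
  have hx0 : 0 < x ^ β := Real.rpow_pos_of_pos hx.1 _
  rcases lt_or_ge x ε with h | h
  · have h1 : ‖u x‖ ≤ C₁ * ‖x ^ β‖ := hεs ⟨hx.1, h⟩
    rw [Real.norm_of_nonneg hx0.le] at h1
    exact h1.trans (mul_le_mul_of_nonneg_right
      ((le_max_left _ _).trans (le_max_right _ _)) hx0.le)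
  · have h1 := hC₂ x ⟨h, hx.2⟩
    rw [norm_mul, Complex.norm_real, Real.norm_of_nonneg (Real.rpow_nonneg hx.1.le _),
      Real.rpow_neg hx.1.le, ← div_eq_mul_inv, div_le_iff₀ hx0] at h1
    exact h1.trans (mul_le_mul_of_nonneg_right
      ((le_max_right _ _).trans (le_max_right _ _)) hx0.le)

theorem intervalIntegrable_of_norm_le_rpow {u : ℝ → ℂ} {R α C : ℝ} (hR : 0 ≤ R) (hα : -1 < α)
    (hu : ContinuousOn u (Ioc 0 R)) (hb : ∀ x ∈ Ioc 0 R, ‖u x‖ ≤ C * x ^ α) :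
    IntervalIntegrable u MeasureTheory.volume 0 R := by
  refine IntervalIntegrable.mono_fun'
    ((intervalIntegral.intervalIntegrable_rpow' hα).const_mul C) ?_ ?_
  · rw [uIoc_of_le hR]
    exact hu.aestronglyMeasurable measurableSet_Ioc
  · rw [uIoc_of_le hR]
    exact MeasureTheory.ae_restrict_of_forall_mem measurableSet_Ioc hb

theorem discreteSum_add_sum {q : ℕ} (L : ℝ) (F : ℝ → ℂ) (G : Fin (q + 1) → ℝ → ℂ)
    (a : Fin (q + 1) → ℂ) (N : ℕ) :
    discreteSum L (fun x => F x + ∑ n, a n * G n x) N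
      = discreteSum L F N + ∑ n, a n * discreteSum L (G n) N := by
  have h : ∑ n, a n * discreteSum L (G n) N = 2 * N *
      (∑ i ∈ Finset.Icc 1 (N / 2), ∑ n, a n * G n (L / N * i)
        + normBernoulli 1 ((N % 2 : ℕ) / 2) * ∑ n, a n * G n (L / 2)) := by
    rw [Finset.sum_comm, Finset.mul_sum, ← Finset.sum_add_distrib, Finset.mul_sum]
    refine Finset.sum_congr rfl fun n _ => ?_
    rw [discreteSum, ← Finset.mul_sum]
    ring
  rw [h, discreteSum, discreteSum, Finset.sum_add_distrib]
  ring

theorem bernoulliTerms_add_sum {q : ℕ} (L : ℝ) (F : ℕ → ℝ → ℂ) (G : Fin (q + 1) → ℕ → ℝ → ℂ)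
    (a : Fin (q + 1) → ℂ) (p N : ℕ) :
    bernoulliTerms L (fun k x => F k x + ∑ n, a n * G n k x) p N
      = bernoulliTerms L F p N + ∑ n, a n * bernoulliTerms L (G n) p N := by
  have h : ∑ n, a n * bernoulliTerms L (G n) p N = 2 * N *
      ∑ i ∈ Finset.Icc 1 p, normBernoulli (2 * i) ((N % 2 : ℕ) / 2)
        * ((L / N : ℝ) : ℂ) ^ (2 * i - 1) * ∑ n, a n * G n (2 * i - 1) (L / 2) := by
    simp_rw [Finset.mul_sum (s := Finset.univ)]
    rw [Finset.sum_comm, Finset.mul_sum]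
    refine Finset.sum_congr rfl fun n _ => ?_
    rw [bernoulliTerms, Finset.mul_sum, Finset.mul_sum, Finset.mul_sum]
    refine Finset.sum_congr rfl fun i _ => ?_
    ring
  rw [h, bernoulliTerms, bernoulliTerms, ← mul_add, ← Finset.sum_add_distrib]
  congr 1
  refine Finset.sum_congr rfl fun i _ => ?_
  ring

theorem normBernoulli_half (k κ : ℕ) : normBernoulli k ((κ : ℝ) / 2) =
    (((Polynomial.bernoulli k).eval ((κ : ℚ) / 2) : ℚ) : ℂ) / (k.factorial : ℂ) := by
  have h : bernoulliFun k ((κ : ℝ) / 2)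
      = (((Polynomial.bernoulli k).eval ((κ : ℚ) / 2) : ℚ) : ℝ) := by
    have h1 := Polynomial.eval_map_algebraMap (Polynomial.bernoulli k) (B := ℝ) ((κ : ℝ) / 2)
    have h2 := Polynomial.aeval_algebraMap_apply ℝ ((κ : ℚ) / 2) (Polynomial.bernoulli k)
    rw [bernoulliFun, h1]
    simpa using h2
  rw [normBernoulli, h]
  push_cast
  rfl

theorem bernoulliSum_eq_bernoulliTerms {L : ℝ} (hL : 0 < L) {f : ℝ → ℂ} {D : ℕ → ℝ → ℂ} {p N : ℕ}
    (hN : 1 ≤ N)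
    (hD : ∀ k ≤ 2 * p + 1, iteratedDerivWithin k f (Ioc 0 (L / 2)) (L / 2) = D k (L / 2)) :
    bernoulliSum L f p N = bernoulliTerms L D p N := by
  have hNc : (N : ℂ) ≠ 0 := by exact_mod_cast (by omega : N ≠ 0)
  have hLc : (L : ℂ) ≠ 0 := by exact_mod_cast hL.ne'
  rw [bernoulliSum, bernoulliTerms, Finset.mul_sum, Finset.mul_sum]
  refine Finset.sum_congr rfl fun n hn => ?_
  rw [Finset.mem_Icc] at hn
  rw [hD _ (by omega), normBernoulli_half]
  obtain ⟨k, hk⟩ : ∃ k, 2 * n = k + 1 := ⟨2 * n - 1, by omega⟩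
  rw [show 2 * n - 1 = k by omega, hk, pow_succ ((L : ℂ) / N) k]
  push_cast
  field_simp

theorem sum_power_main_terms {L : ℝ} (hL : 0 < L) (f : ℝ → ℂ) {q : ℕ} (a s : Fin (q + 1) → ℂ)
    {q' : Fin (q + 1)} (hq' : s q' = 1) (hne : ∀ n, n ≠ q' → s n ≠ 1) (p : ℕ) {N : ℕ} (hN : 2 ≤ N) :
    exceptionalExpansion L f p a s q' N =
      2 * N * ((L / N : ℝ) : ℂ)⁻¹ * (∫ x in (0 : ℝ)..L / 2, (f x - powerSum a s x))
      + ∑ n, a n * (2 * N * ((L / N : ℝ) : ℂ) ^ (-s n) *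
        ((∫ x in (1 : ℝ)..(N : ℝ) / 2, powDeriv (s n) 0 x) + riemannZeta₀ (s n)))
      + bernoulliSum L f p N := by
  have hNc : (N : ℂ) ≠ 0 := by exact_mod_cast (by omega : N ≠ 0)
  have hLc : (L : ℂ) ≠ 0 := by exact_mod_cast hL.ne'
  have e : ∑ n ∈ Finset.univ.erase q', a n * (2 * N * ((L / N : ℝ) : ℂ) ^ (-s n) *
        ((∫ x in (1 : ℝ)..(N : ℝ) / 2, powDeriv (s n) 0 x) + riemannZeta₀ (s n)))
      = 2 / (L : ℂ) * (N : ℂ) ^ 2 * (∑ n ∈ Finset.univ.erase q',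
          a n * (((L / 2 : ℝ) : ℂ) ^ (1 - s n) / (1 - s n)))
        + ∑ n ∈ Finset.univ.erase q',
          a n * (2 * riemannZeta (s n) / (L : ℂ) ^ (s n)) * (N : ℂ) ^ (1 + s n) := by
    rw [Finset.mul_sum, ← Finset.sum_add_distrib]
    refine Finset.sum_congr rfl fun n hn => ?_
    rw [power_main_term hL (hne n (Finset.ne_of_mem_erase hn)) hN]
    ring
  have hinv : 2 * (N : ℂ) * ((L / N : ℝ) : ℂ)⁻¹ = 2 / (L : ℂ) * (N : ℂ) ^ 2 := by
    push_cast
    field_simp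
  rw [← Finset.add_sum_erase _ _ (Finset.mem_univ q'), e, hq', exceptional_main_term hL hN, hinv,
    exceptionalExpansion, exceptionalCoeff]
  ring

/-! ### Assembly and the two remainder regimes -/

/-- A bound for the remainder from which both asymptotic regimes are read off. -/
theorem discreteSum_sub_exceptionalExpansion_le {L : ℝ} (hL : 0 < L) {f : ℝ → ℂ} {p q : ℕ}
    {a s : Fin (q + 1) → ℂ} {δ : ℝ} (hf : IsAdmissible L f p a s δ)
    {q' : Fin (q + 1)} (hq' : s q' = 1) :
    IntervalIntegrable (fun x => f x - powerSum a s x) MeasureTheory.volume 0 (L / 2) ∧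
    ∃ K, 0 ≤ K ∧ ∀ N : ℕ, 2 ≤ N →
      ‖discreteSum L f N - exceptionalExpansion L f p a s q' N‖ ≤
        K * ((N : ℝ) ^ (1 - (δ - (s (Fin.last q)).re)) * (1 + ∫ x in (1 : ℝ)..(N : ℝ) / 2,
          x ^ (δ - (s (Fin.last q)).re - (2 * p + 1))) + (N : ℝ) ^ (-(2 * (p : ℝ)))) := by
  obtain ⟨I, hI⟩ : ∃ I, I = Ioc 0 (L / 2) := ⟨_, rfl⟩
  have huI : UniqueDiffOn ℝ I := hI ▸ uniqueDiffOn_Ioc 0 (L / 2)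
  have hIpos : ∀ x ∈ I, 0 < x := fun x hx => (hI ▸ hx : x ∈ Ioc 0 (L / 2)).1
  have hLI : L / 2 ∈ I := hI ▸ ⟨by positivity, le_rfl⟩
  obtain ⟨α, hαdef⟩ : ∃ α, α = δ - (s (Fin.last q)).re := ⟨_, rfl⟩
  have hα : -1 < α := by rw [hαdef]; linarith [hf.exponent_pos]
  rw [← hαdef]
  have hlast : -(2 * (p : ℝ)) ≤ (s (Fin.last q)).re := by
    rcases hf.last_exponent with h | h
    · linarith
    · rw [h]; simp
  -- The last exponent has the smallest real part, which is at least `-2p`, so every power lies in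
  -- the half-plane of the zeta expansion.
  have hre : ∀ n, -(2 * (p : ℝ) + 1) < (s n).re := fun n => by
    have h : (s (Fin.last q)).re ≤ (s n).re := hf.re_strictAnti.antitone (Fin.le_last n)
    linarith
  have hne : ∀ n, n ≠ q' → s n ≠ 1 := fun n hn h =>
    hn (hf.re_strictAnti.injective (by simp only [h, hq']))
  have hS : ∀ k, ∀ x ∈ I,
      HasDerivWithinAt (powerSumDeriv a s k) (powerSumDeriv a s (k + 1) x) I x := fun k x hx =>
    (hasDerivAt_powerSumDeriv a s k (hIpos x hx)).hasDerivWithinAt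
  set g : ℝ → ℂ := fun y => f y - powerSum a s y
  have hcd : ContDiffOn ℝ ((2 * p + 1 : ℕ) : WithTop ℕ∞) g I := by
    have h := contDiffOn_of_hasDerivWithinAt_family huI hS (2 * p + 1)
    rw [powerSumDeriv_zero] at h
    exact (hI ▸ hf.contDiffOn).sub h
  set G : ℕ → ℝ → ℂ := fun k => iteratedDerivWithin k g I
  have hG0 : G 0 = g := by ext x; simp [G]
  have hGc : ∀ k ≤ 2 * p + 1, ContinuousOn (G k) I := fun k hk =>
    hcd.continuousOn_iteratedDerivWithin (by exact_mod_cast hk) huI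
  have hGd : ∀ k < 2 * p + 1, ∀ x ∈ I, HasDerivWithinAt (G k) (G (k + 1) x) I x := by
    intro k hk x hx
    have := (hcd.differentiableOn_iteratedDerivWithin (by exact_mod_cast hk) huI x
      hx).hasDerivWithinAt
    simpa only [G, iteratedDerivWithin_succ] using this
  have hGb : ∀ k, k ≤ 2 * p + 1 → ∃ C, 0 ≤ C ∧ ∀ x ∈ Ioc 0 (L / 2), ‖G k x‖ ≤ C * x ^ (α - k) := by
    intro k hk
    refine exists_norm_le_rpow (hI ▸ hGc k hk) ?_
    have h := hf.deriv_isBigO k hk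
    rw [← hI] at h
    refine h.trans (IsBigO.of_bound 1 ?_)
    filter_upwards [self_mem_nhdsWithin] with x hx
    rw [Complex.norm_cpow_eq_rpow_re_of_pos hx, one_mul, hαdef]
    simp only [Complex.sub_re, Complex.ofReal_re, Complex.natCast_re]
    exact le_abs_self _
  choose! C hC0 hC using hGb
  have hGbound : ∀ k ≤ 2 * p + 1, ∀ x ∈ Ioc 0 (L / 2),
      ‖G k x‖ ≤ (∑ j ∈ Finset.range (2 * p + 2), C j) * x ^ (α - k) := by
    intro k hk x hx
    refine (hC k hk x hx).trans (mul_le_mul_of_nonneg_right ?_ (Real.rpow_nonneg hx.1.le _))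
    exact Finset.single_le_sum (f := C)
      (fun j hj => hC0 j (by rw [Finset.mem_range] at hj; omega)) (Finset.mem_range.2 (by omega))
  have hint : IntervalIntegrable (G 0) MeasureTheory.volume 0 (L / 2) := by
    refine intervalIntegrable_of_norm_le_rpow (C := C 0) (by positivity) hα (hI ▸ hGc 0 (by omega))
      fun x hx => ?_
    simpa using hC 0 (by omega) x hx
  refine ⟨hG0 ▸ hint, ?_⟩
  obtain ⟨K₁, hK₁, hb₁⟩ := discreteSum_sub_le hL hα (fun k hk => hI ▸ hGc k hk)
    (fun k hk x hx => (hGd k hk x (hI ▸ Ioo_subset_Ioc_self hx)).hasDerivAt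
      (hI ▸ Ioc_mem_nhds hx.1 hx.2)) hGbound hint
  choose K₂ hb₂ using fun n => discreteSum_powDeriv_sub_le hL (hre n)
  have hf0 : f = fun x => G 0 x + ∑ n, a n * powDeriv (s n) 0 x := by
    ext x
    have := congrFun (powerSumDeriv_zero a s) x
    rw [powerSumDeriv] at this
    rw [this, hG0]
    simp [g]
  -- The one-sided derivatives of `f` at `L / 2` split like `f`, so the Bernoulli terms of `g` and
  -- of the powers add up to those of `f`.
  have hfD : ∀ k ≤ 2 * p + 1, iteratedDerivWithin k f (Ioc 0 (L / 2)) (L / 2)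
      = G k (L / 2) + ∑ n, a n * powDeriv (s n) k (L / 2) := by
    intro k hk
    have h := iteratedDerivWithin_eq_of_hasDerivWithinAt (m := 2 * p + 1)
      (D := fun k x => G k x + ∑ n, a n * powDeriv (s n) k x) huI
      (fun k hk x hx => (hGd k hk x hx).add (hS k x hx)) k hk hLI
    rw [← hf0, hI] at h
    exact h
  have hKsum : 0 ≤ ∑ n, ‖a n‖ * |K₂ n| := by positivity
  refine ⟨K₁ + ∑ n, ‖a n‖ * |K₂ n|, by positivity, fun N hN => ?_⟩
  have hN2 : (2 : ℝ) ≤ N := by exact_mod_cast hN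
  have hdiff : discreteSum L f N - exceptionalExpansion L f p a s q' N
      = (discreteSum L (G 0) N
          - 2 * N * ((L / N : ℝ) : ℂ)⁻¹ * (∫ x in (0 : ℝ)..L / 2, G 0 x) - bernoulliTerms L G p N)
        + ∑ n, a n * (discreteSum L (powDeriv (s n) 0) N
          - 2 * N * ((L / N : ℝ) : ℂ) ^ (-s n) *
            ((∫ x in (1 : ℝ)..(N : ℝ) / 2, powDeriv (s n) 0 x) + riemannZeta₀ (s n))
          - bernoulliTerms L (powDeriv (s n)) p N) := by
    rw [sum_power_main_terms hL f a s hq' hne p hN,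
      bernoulliSum_eq_bernoulliTerms
        (D := fun k x => G k x + ∑ n, a n * powDeriv (s n) k x) hL (by omega) hfD,
      bernoulliTerms_add_sum L G (fun n => powDeriv (s n)) a, hG0]
    have h1 : discreteSum L f N = discreteSum L g N
        + ∑ n, a n * discreteSum L (powDeriv (s n) 0) N := by
      rw [← hG0, ← discreteSum_add_sum L (G 0) (fun n => powDeriv (s n) 0) a, ← hf0]
    rw [h1]
    simp only [mul_sub, Finset.sum_sub_distrib]
    ring
  rw [hdiff]
  set J := ∫ x in (1 : ℝ)..(N : ℝ) / 2, x ^ (α - (2 * p + 1))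
  have hJ : 0 ≤ J := intervalIntegral.integral_nonneg (by linarith) fun x hx =>
    Real.rpow_nonneg (by linarith [hx.1]) _
  have h2 : ‖∑ n, a n * (discreteSum L (powDeriv (s n) 0) N
          - 2 * N * ((L / N : ℝ) : ℂ) ^ (-s n) *
            ((∫ x in (1 : ℝ)..(N : ℝ) / 2, powDeriv (s n) 0 x) + riemannZeta₀ (s n))
          - bernoulliTerms L (powDeriv (s n)) p N)‖
      ≤ (∑ n, ‖a n‖ * |K₂ n|) * (N : ℝ) ^ (-(2 * (p : ℝ))) := by
    rw [Finset.sum_mul]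
    refine norm_sum_le_of_le _ fun n _ => ?_
    rw [norm_mul, mul_assoc ‖a n‖]
    exact mul_le_mul_of_nonneg_left ((hb₂ n N hN).trans
      (mul_le_mul_of_nonneg_right (le_abs_self _) (by positivity))) (norm_nonneg _)
  refine (norm_add_le _ _).trans ((add_le_add (hb₁ N hN) h2).trans ?_)
  have t1 : 0 ≤ (N : ℝ) ^ (1 - α) * (1 + J) := by positivity
  have t2 : 0 ≤ (N : ℝ) ^ (-(2 * (p : ℝ))) := by positivity
  have t3 := mul_nonneg hKsum t1
  have t4 := mul_nonneg hK₁ t2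
  nlinarith

/-- The integral equals `((N/2) ^ (α - β) - 1) / (α - β)`; multiplied by `N ^ (1 - α)`, its two
parts have orders `N ^ (1 - β)` and `N ^ (1 - α)`. Absolute values handle both signs of `α - β`. -/
theorem remainder_bound_of_ne {α β : ℝ} (h : β ≠ α) :
    ∃ K, 0 ≤ K ∧ ∀ N : ℕ, 2 ≤ N →
      (N : ℝ) ^ (1 - α) * (1 + ∫ x in (1 : ℝ)..(N : ℝ) / 2, x ^ (α - (β + 1)))
        + (N : ℝ) ^ (-β) ≤ K * ((N : ℝ) ^ (1 - β) + (N : ℝ) ^ (1 - α)) := by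
  have hne : α - β ≠ 0 := sub_ne_zero.2 h.symm
  have hpos : 0 < |α - β| := abs_pos.2 hne
  refine ⟨2 + (2 ^ (β - α) + 1) / |α - β|, by positivity, fun N hN => ?_⟩
  have hN2 : (2 : ℝ) ≤ N := by exact_mod_cast hN
  have hN0 : (0 : ℝ) < N := by linarith
  have hJ : ∫ x in (1 : ℝ)..(N : ℝ) / 2, x ^ (α - (β + 1))
      = (((N : ℝ) / 2) ^ (α - β) - 1) / (α - β) := by
    rw [integral_rpow (Or.inr ⟨fun h' => hne (by linarith), fun h0 => ?_⟩),
      show α - (β + 1) + 1 = α - β by ring, Real.one_rpow]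
    rw [uIcc_of_le (by linarith)] at h0
    linarith [h0.1]
  have hJle : (((N : ℝ) / 2) ^ (α - β) - 1) / (α - β)
      ≤ (((N : ℝ) / 2) ^ (α - β) + 1) / |α - β| := by
    refine (le_abs_self _).trans ?_
    rw [abs_div]
    refine div_le_div_of_nonneg_right ?_ hpos.le
    have : 0 ≤ ((N : ℝ) / 2) ^ (α - β) := by positivity
    rw [abs_le]
    constructor <;> linarith
  have hmul : (N : ℝ) ^ (1 - α) * ((N : ℝ) / 2) ^ (α - β) = 2 ^ (β - α) * (N : ℝ) ^ (1 - β) := by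
    rw [Real.div_rpow hN0.le two_pos.le, show β - α = -(α - β) by ring, Real.rpow_neg two_pos.le,
      show 1 - β = 1 - α + (α - β) by ring, Real.rpow_add hN0]
    ring
  have hle : (N : ℝ) ^ (-β) ≤ (N : ℝ) ^ (1 - β) :=
    Real.rpow_le_rpow_of_exponent_le (by linarith) (by linarith)
  have hA : 0 ≤ (N : ℝ) ^ (1 - α) := by positivity
  have hB : 0 ≤ (N : ℝ) ^ (1 - β) := by positivity
  rw [hJ]
  calc _ ≤ (N : ℝ) ^ (1 - α) * (1 + (((N : ℝ) / 2) ^ (α - β) + 1) / |α - β|)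
        + (N : ℝ) ^ (1 - β) := by gcongr
    _ = (N : ℝ) ^ (1 - α) + (N : ℝ) ^ (1 - β)
        + ((N : ℝ) ^ (1 - α) * ((N : ℝ) / 2) ^ (α - β) + (N : ℝ) ^ (1 - α)) / |α - β| := by ring
    _ ≤ 2 * ((N : ℝ) ^ (1 - β) + (N : ℝ) ^ (1 - α))
        + ((2 ^ (β - α) + 1) * ((N : ℝ) ^ (1 - β) + (N : ℝ) ^ (1 - α))) / |α - β| := by
      rw [hmul]
      have h2 : (0 : ℝ) ≤ 2 ^ (β - α) := by positivity
      have h3 := mul_nonneg h2 hA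
      gcongr
      · linarith
      · nlinarith
    _ = _ := by ring

theorem remainder_bound_of_eq (β : ℝ) :
    ∃ K, 0 ≤ K ∧ ∀ N : ℕ, 2 ≤ N →
      (N : ℝ) ^ (1 - β) * (1 + ∫ x in (1 : ℝ)..(N : ℝ) / 2, x ^ (β - (β + 1)))
        + (N : ℝ) ^ (-β) ≤ K * ((N : ℝ) ^ (1 - β) * Real.log N) := by
  -- Here the integral is `log (N / 2)`, and `5` works because `2 - log 2 ≤ 4 log 2 ≤ 4 log N`.
  refine ⟨5, by norm_num, fun N hN => ?_⟩
  have hN2 : (2 : ℝ) ≤ N := by exact_mod_cast hN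
  have hN0 : (0 : ℝ) < N := by linarith
  have hJ : ∫ x in (1 : ℝ)..(N : ℝ) / 2, x ^ (β - (β + 1)) = Real.log ((N : ℝ) / 2) := by
    simp only [sub_add_cancel_left, Real.rpow_neg_one]
    rw [integral_inv_of_pos one_pos (by positivity), div_one]
  have hlog : Real.log 2 ≤ Real.log N := Real.log_le_log two_pos hN2
  have hlog2 := Real.log_two_gt_d9
  have hle : (N : ℝ) ^ (-β) ≤ (N : ℝ) ^ (1 - β) :=
    Real.rpow_le_rpow_of_exponent_le (by linarith) (by linarith)
  have hB : 0 ≤ (N : ℝ) ^ (1 - β) := by positivity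
  rw [hJ, Real.log_div hN0.ne' two_ne_zero]
  nlinarith [mul_le_mul_of_nonneg_left (show 2 - Real.log 2 ≤ 4 * Real.log N by linarith) hB]

theorem mainTheorem2 {d : ℕ} (Γ : RiemannianCircle d) (f : ℝ → ℂ) (p q : ℕ) (hp : 1 ≤ p)
    (a s : Fin (q + 1) → ℂ) (δ : ℝ) (hf : IsAdmissible Γ.length f p a s δ)
    (q' : Fin (q + 1)) (hq' : s q' = 1)
    (z : (N : ℕ) → Fin N → EuclideanSpace ℝ (Fin d))
    (hz : ∀ N, 2 ≤ N → Γ.IsEquallySpaced (z N)) :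
    IntervalIntegrable (fun x => f x - powerSum a s x) MeasureTheory.volume 0 (Γ.length / 2) ∧
    ((2 * (p : ℝ) ≠ δ - (s (Fin.last q)).re →
      (fun N : ℕ => Γ.energy f (z N) - exceptionalExpansion Γ.length f p a s q' N)
        =O[atTop] fun N : ℕ =>
          (N : ℝ) ^ (1 - 2 * (p : ℝ)) + (N : ℝ) ^ (1 - δ + (s (Fin.last q)).re)) ∧
    (2 * (p : ℝ) = δ - (s (Fin.last q)).re →
      (fun N : ℕ => Γ.energy f (z N) - exceptionalExpansion Γ.length f p a s q' N)
        =O[atTop] fun N : ℕ => (N : ℝ) ^ (1 - 2 * (p : ℝ)) * Real.log N)) := by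
  obtain ⟨hint, K, hK, hb⟩ := discreteSum_sub_exceptionalExpansion_le Γ.length_pos hf hq'
  refine ⟨hint, fun h => ?_, fun h => ?_⟩
  · obtain ⟨K', -, hb'⟩ := remainder_bound_of_ne h
    refine IsBigO.of_bound (K * K') ?_
    filter_upwards [eventually_ge_atTop 2] with N hN
    rw [Γ.energy_eq_discreteSum f hN (hz N hN), sub_add, Real.norm_of_nonneg (by positivity),
      mul_assoc]
    exact (hb N hN).trans (mul_le_mul_of_nonneg_left (hb' N hN) hK)
  · obtain ⟨K', -, hb'⟩ := remainder_bound_of_eq (2 * (p : ℝ))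
    refine IsBigO.of_bound (K * K') ?_
    filter_upwards [eventually_ge_atTop 2] with N hN
    have hlog : 0 ≤ Real.log (N : ℝ) := Real.log_natCast_nonneg N
    rw [Γ.energy_eq_discreteSum f hN (hz N hN), Real.norm_of_nonneg (by positivity), mul_assoc]
    have := hb N hN
    rw [← h] at this
    exact this.trans (mul_le_mul_of_nonneg_left (hb' N hN) hK)

end
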